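/- **Setting.** Let $(\Omega,\mathcal F,(\mathcal F_s)_{s\ge 0},\mathbb P)$ be a filtered probability space, $0\le t<T<\infty$, $n\in\mathbb N$, and $A_1,\dots,A_n\in\mathcal F_T$. Let $P=(P^1,\dots,P^n)$ be a progressively measurable $[0,1]^n$-valued process with $P^i_s=\mathbb E[\mathbf 1_{A_i}\mid\mathcal F_s]$ a.s. for $0\le s\le T$; its dynamics are otherwise arbitrary. Let $\lambda_i:[0,1]^n\times[0,1]^n\to[0,\infty]$ be Borel functions, and let the revenue $X_t\in\mathbb R$ and the books $Q_t\in\mathbb R^n$ at time $t$ be $\mathcal F_t$-measurable. Under a $[0,1]^n$-valued price process $u$, bets on $A_i$ arrive on $(t,T]$ in one of two ways. * *Continuous arrivals:* $dQ^{u,i}_s=\lambda_i(P_s,u_s)\,ds$, and $u$ is progressively measurable. * *Poisson arrivals:* $dQ^{u,i}_s=dN^{u,i}_s$, where $N^{u,i}$ is an adapted counting process (nondecreasing, right-continuous, with unit jumps) with intensity $\lambda_i(P_s,u_s)$, that is, $\mathbb E[N^{u,i}_s-N^{u,i}_r\mid\mathcal F_r]=\mathbb E[\int_r^s\lambda_i(P_v,u_v)\,dv\mid\mathcal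 F_r]$ for $t\le r\le s\le T$. Here $u$ is predictable, $P$ has a.s. càdlàg paths on $[t,T]$, such processes $N^{u,i}$ are given for every admissible $u$, and a.s. $P^i$ and $N^{u,i}$ have no common jump times. In both cases $u$ is *admissible* if in addition the expected number of bets $\mathbb E\int_t^T\lambda_i(P_s,u_s)\,ds$ is finite for every $i$. Assume that at least one admissible $u$ exists. The terminal wealth is $$Y^u_T=X_t+\sum_{i=1}^n\int_{(t,T]}u^i_s\,dQ^{u,i}_s-\sum_{i=1}^n\mathbf 1_{A_i}\Big(Q^i_t+\int_{(t,T]}dQ^{u,i}_s\Big).$$ Write $\mathbb E_{t,x,p,q}[\,\cdot\,]=\mathbb E[\,\cdot\mid X_t=x,P_t=p,Q_t=q]$, and let the value function of the risk-neutral bookmaker ($U(y)=y$) be $$V(t,x,p,q)=\sup_{u\text{ admissible}}\mathbb E_{t,x,p,q}[Y^u_T]\in(-\infty,\infty].$$ As conditional expectations given the state are defined only up to null sets of the law of $(X_t,P_t,Q_t)$, this supremum is the essential supremum with respect to that law (the ordinary supremum at $(x,p,q)$ if $(X_t,P_t,Q_t)=(x,p,q)$ a.s.). **Theorem.** In each of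 the two arrival models, for almost every $(x,p,q)$ with respect to the law of $(X_t,P_t,Q_t)$, $$V(t,x,p,q)=x-p\cdot q+\mathbb E_{t,x,p,q}\int_t^T\ \sup_{\hat u}\ \sum_{i=1}^n\lambda_i(P_s,\hat u)\,(\hat u_i-P^i_s)\,ds ,$$ where $p\cdot q=\sum_i p_iq_i$ and the supremum is over all $\hat u\in[0,1]^n$ at which the rates $\lambda_1(P_s,\hat u),\dots,\lambda_n(P_s,\hat u)$ are finite. Both sides may equal $+\infty$. Thus the dynamic control problem reduces to a static optimization at each time. -/

import Mathlib

open MeasureTheory ProbabilityTheory Set Filter Topology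
open scoped NNReal ENNReal

noncomputable section

/-- The set `[0,1]^n` of probability vectors and of price vectors. -/
abbrev Cube (n : ℕ) : Type := Fin n → unitInterval

/-- Lebesgue measure on the time axis `[0, ∞)`. -/
def timeMeasure : Measure ℝ≥0 := Measure.comap ((↑) : ℝ≥0 → ℝ) volume

/-- The extended integral `∫ f⁺ - ∫ f⁻` of an extended real function
(with the convention `∞ - ∞ = -∞`). -/
def extIntegral {α : Type*} {_ : MeasurableSpace α} (ν : Measure α) (f : α → EReal) : EReal :=
  ((∫⁻ a, (f a).toENNReal ∂ν : ℝ≥0∞) : EReal) - ((∫⁻ a, (-f a).toENNReal ∂ν : ℝ≥0∞) : EReal)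

/-- The state `(x, p, q)`: revenue, conditional probabilities, numbers of bets. -/
abbrev MarketState (n : ℕ) : Type := ℝ × Cube n × (Fin n → ℝ)

/-- A price process (or any other process with values in `[0,1]^n`). -/
abbrev CubeProcess (Ω : Type*) (n : ℕ) : Type _ := ℝ≥0 → Ω → Cube n

section Market

variable {Ω : Type*} {mΩ : MeasurableSpace Ω} {n : ℕ}

/-- `P` is a (progressively measurable, `[0,1]^n`-valued) version of the process of conditional
probabilities `P_s^i = E[1_{A_i} | ℱ_s]`, `0 ≤ s ≤ T`, of the outcomes `A_i ∈ ℱ_T`. -/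
structure IsConditionalProbability (μ : Measure Ω) (ℱ : Filtration ℝ≥0 mΩ) (T : ℝ≥0)
    (A : Fin n → Set Ω) (P : CubeProcess Ω n) : Prop where
  outcome_measurable : ∀ i, MeasurableSet[ℱ T] (A i)
  progressive : IsStronglyProgressive ℱ P
  version : ∀ s, s ≤ T → ∀ i,
    (fun ω => (P s ω i : ℝ)) =ᵐ[μ] μ[(A i).indicator (fun _ => (1 : ℝ)) | ℱ s]

/-- The paths of the process `P` are almost surely right-continuous with left limits
on `[t, T]`. -/
def IsCadlagOn (μ : Measure Ω) (P : CubeProcess Ω n) (t T : ℝ≥0) : Prop :=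
  ∀ᵐ ω ∂μ,
    (∀ s ∈ Ico t T, ContinuousWithinAt (fun r => P r ω) (Ici s) s) ∧
    (∀ s ∈ Ioc t T, ∃ l, Tendsto (fun r => P r ω) (𝓝[<] s) (𝓝 l))

/-! ### Admissible pricing strategies -/

/-- Under the price process `u`, the expected number of bets on each outcome placed
during `(t, T]` is finite. -/
def FiniteExpectedBets (μ : Measure Ω) (lam : Fin n → Cube n → Cube n → ℝ≥0∞)
    (P : CubeProcess Ω n) (t T : ℝ≥0) (u : CubeProcess Ω n) : Prop :=
  ∀ i, ∫⁻ ω, ∫⁻ s in Ioc t T, lam i (P s ω) (u s ω) ∂timeMeasure ∂μ ≠ ∞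

/-- Admissible strategies for continuous arrivals: progressively measurable price processes. -/
def admissibleContinuous (μ : Measure Ω) (ℱ : Filtration ℝ≥0 mΩ)
    (lam : Fin n → Cube n → Cube n → ℝ≥0∞) (P : CubeProcess Ω n) (t T : ℝ≥0) :
    Set (CubeProcess Ω n) :=
  {u | IsStronglyProgressive ℱ u ∧ FiniteExpectedBets μ lam P t T u}

/-- Admissible strategies for Poisson arrivals: predictable price processes, that is, the price
at which a bet is placed is the one posted before the bet arrives. -/
def admissiblePoisson (μ : Measure Ω) (ℱ : Filtration ℝ≥0 mΩ)
    (lam : Fin n → Cube n → Cube n → ℝ≥0∞) (P : CubeProcess Ω n) (t T : ℝ≥0) :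
    Set (CubeProcess Ω n) :=
  {u | IsStronglyPredictable ℱ u ∧ FiniteExpectedBets μ lam P t T u}

/-! ### The two models for the arrival of bets

In both models the arrivals during `(t, T]` of bets on the `i`-th outcome are described by the
random measure `dQ^{u,i}` on the time axis. -/

/-- Continuous arrivals: `dQ^{u,i}_s = λ_i(P_s, u_s) ds`. -/
def continuousArrivals (lam : Fin n → Cube n → Cube n → ℝ≥0∞) (P : CubeProcess Ω n)
    (t T : ℝ≥0) (u : CubeProcess Ω n) (i : Fin n) (ω : Ω) : Measure ℝ≥0 :=
  (timeMeasure.restrict (Ioc t T)).withDensity (fun s => lam i (P s ω) (u s ω))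

/-- The times in `(t, T]` at which the nondecreasing path `N` jumps. -/
def jumpTimes (N : ℝ≥0 → ℕ) (t T : ℝ≥0) : Set ℝ≥0 :=
  {s | s ∈ Ioc t T ∧ ∀ r ∈ Ico t s, N r < N s}

/-- `N^i`, `i = 1, …, n`, are (the restrictions to `[t, T]` of) state-dependent Poisson processes
with instantaneous intensities `λ_i(P_s, u_s)`: adapted counting processes (nondecreasing,
right-continuous, with jumps of size one) such that `E[dN_s^i | ℱ_s] = λ_i(P_s, u_s) ds`, i.e.
`E[N_s^i - N_r^i | ℱ_r] = E[∫_r^s λ_i(P_v, u_v) dv | ℱ_r]` for `t ≤ r ≤ s ≤ T`. -/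
structure IsControlledPoisson (μ : Measure Ω) (ℱ : Filtration ℝ≥0 mΩ)
    (lam : Fin n → Cube n → Cube n → ℝ≥0∞) (P : CubeProcess Ω n) (t T : ℝ≥0)
    (u : CubeProcess Ω n) (N : Fin n → ℝ≥0 → Ω → ℕ) : Prop where
  adapted : ∀ i s, Measurable[ℱ s] (N i s)
  monotone : ∀ i, ∀ᵐ ω ∂μ, MonotoneOn (fun s => N i s ω) (Icc t T)
  right_continuous : ∀ i, ∀ᵐ ω ∂μ, ∀ s ∈ Ico t T,
    ContinuousWithinAt (fun r => N i r ω) (Ici s) s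
  unit_jumps : ∀ i, ∀ᵐ ω ∂μ, ∀ s ∈ Ioc t T, ∃ r ∈ Ico t s, N i s ω ≤ N i r ω + 1
  intensity : ∀ i, ∀ r s, t ≤ r → r ≤ s → s ≤ T → ∀ B, MeasurableSet[ℱ r] B →
    ∫⁻ ω in B, ((N i s ω - N i r ω : ℕ) : ℝ≥0∞) ∂μ
      = ∫⁻ ω in B, ∫⁻ v in Ioc r s, lam i (P v ω) (u v ω) ∂timeMeasure ∂μ

/-- Almost surely, `P^i` does not jump at the times in `(t, T]` at which `N^i` jumps. -/
def NoCommonJumps (μ : Measure Ω) (P : CubeProcess Ω n) (t T : ℝ≥0)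
    (N : Fin n → ℝ≥0 → Ω → ℕ) : Prop :=
  ∀ i, ∀ᵐ ω ∂μ, ∀ s ∈ jumpTimes (fun r => N i r ω) t T,
    ContinuousWithinAt (fun r => P r ω i) (Iic s) s

/-- Poisson arrivals: `dQ^{u,i} = dN^{u,i}` has a unit mass at every jump time of `N^{u,i}`
in `(t, T]`. -/
def poissonArrivals (N : Fin n → ℝ≥0 → Ω → ℕ) (t T : ℝ≥0) (i : Fin n) (ω : Ω) : Measure ℝ≥0 :=
  Measure.count.restrict (jumpTimes (fun r => N i r ω) t T)

/-! ### Terminal wealth, objective and value function -/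

/-- `Y_T^u = X_T^u - ∑ 1_{A_i} Q_T^{u,i}`, where the revenue and the books at time `t` are `X` and
`Q`, so that `X_T^u = X + ∑ ∫_{(t,T]} u_s^i dQ_s^{u,i}` and `Q_T^{u,i} = Q^i + ∫_{(t,T]} dQ_s^{u,i}`;
`dQ` is the family of arrival measures on `(t, T]`. -/
def terminalWealth (A : Fin n → Set Ω) (X : Ω → ℝ) (Q : Ω → Fin n → ℝ)
    (dQ : Fin n → Ω → Measure ℝ≥0) (u : CubeProcess Ω n) (ω : Ω) : ℝ :=
  (X ω + ∑ i, ∫ s, (u s ω i : ℝ) ∂(dQ i ω))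
    - ∑ i, (A i).indicator (fun _ => (1 : ℝ)) ω * (Q ω i + (dQ i ω).real univ)

/-- The state `(X_t, P_t, Q_t)` at time `t`. -/
def stateAt (P : CubeProcess Ω n) (t : ℝ≥0) (X : Ω → ℝ) (Q : Ω → Fin n → ℝ) (ω : Ω) :
    MarketState n :=
  (X ω, P t ω, Q ω)

/-- The objective `(x, p, q) ↦ E[U(Y) | X_t = x, P_t = p, Q_t = q]`, the integral of `U` against
the regular conditional law of the terminal wealth `Y` given the state `S = (X_t, P_t, Q_t)`. -/
def objective (μ : Measure Ω) [IsFiniteMeasure μ] (U : ℝ → ℝ) (S : Ω → MarketState n)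
    (Y : Ω → ℝ) (z : MarketState n) : ℝ :=
  ∫ y, U y ∂(condDistrib Y S μ z)

/-- `V` is the supremum over the strategies `u ∈ 𝒜` of the functions `J u` of the state. As
conditional expectations, these are determined up to null sets of the law `ν` of the state only, so
the supremum is the essential one: the least measurable majorant up to `ν`-null sets. If the state
is deterministic, it is the ordinary supremum at that state. -/
def IsValueFunction (ν : Measure (MarketState n)) (𝒜 : Set (CubeProcess Ω n))
    (J : CubeProcess Ω n → MarketState n → ℝ) (V : MarketState n → EReal) : Prop :=
  AEMeasurable V ν ∧
  (∀ u ∈ 𝒜, ∀ᵐ z ∂ν, (J u z : EReal) ≤ V z) ∧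
  ∀ W : MarketState n → EReal, AEMeasurable W ν →
    (∀ u ∈ 𝒜, ∀ᵐ z ∂ν, (J u z : EReal) ≤ W z) → V ≤ᵐ[ν] W

/-! ### The static optimization -/

/-- `sup_û ∑ λ_i(p, û) (û_i - p_i)` over the price vectors `û ∈ [0,1]^n` at which all rates
`λ_i(p, û)` are finite. -/
def staticValue (lam : Fin n → Cube n → Cube n → ℝ≥0∞) (p : Cube n) : EReal :=
  ⨆ v : Cube n, ⨆ _ : ∀ i, lam i p v ≠ ∞,
    ((∑ i, (lam i p v).toReal * ((v i : ℝ) - (p i : ℝ)) : ℝ) : EReal)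

/-- `x - p · q + E[∫_t^T sup_û ∑ λ_i(P_s, û) (û_i - P_s^i) ds | X_t = x, P_t = p, Q_t = q]`,
where `S = (X_t, P_t, Q_t)`. -/
def staticFormula (μ : Measure Ω) [IsFiniteMeasure μ]
    (lam : Fin n → Cube n → Cube n → ℝ≥0∞) (P : CubeProcess Ω n) (t T : ℝ≥0)
    (S : Ω → MarketState n) (z : MarketState n) : EReal :=
  ((z.1 - ∑ i, (z.2.1 i : ℝ) * z.2.2 i : ℝ) : EReal)
    + extIntegral
        (condDistrib
          (fun ω => extIntegral (timeMeasure.restrict (Ioc t T)) (fun s => staticValue lam (P s ω)))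
          S μ z)
        (fun y => y)

end Market

end

/-! Risk neutrality makes the objective linear in the cash flow, and the control does not influence
`P`. A bet on `A i` arriving at time `s` brings in the price `u s ω i` and costs the indicator of `A
i`. Conditionally on `ℱ s` that cost is `P s ω i`, and bets arrive at rate `lam i`. So on every
event of `ℱ t` the new bets have the same expectation as the time integral of `profitRate`, while
the old book contributes `-p · q` (`exists_cashFlow`, `objective_ae_eq`). Since the profit rate at
time `s` depends only on `P s` and `u s`, no strategy trades one time against another, and
`staticValue` bounds the rate pointwise.

The bound is approached as follows. `exists_measurable_selection` gives countably many Borel price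
maps that approximate the static supremum and have bounded rates. Starting from an admissible
strategy, `exists_strategies_tendsto_staticValue` switches to these maps one after the other
wherever the profit rate does not fall. Each switch adds at most a constant to the rates, so
admissibility survives, and the profit rates increase to the static value almost everywhere.
Monotone convergence in time and then under the conditional law given the state yields the formula
(`isValueFunction_staticFormula`).

The arrival models differ only in how the expected cash flow is computed. For continuous arrivals
one applies Tonelli and conditions at each fixed time. For Poisson arrivals the revenue follows from
the compensation formula for predictable integrands (`IsControlledPoisson.lintegral_predictable`).
In the liabilities the outcome is first replaced by `P` at the jump times by conditioning on a
refining grid. As `P i` and `N i` do not jump together, `P i` may then be replaced by a predictable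
version of its left limits, to which the compensation formula applies. That version agrees with `P`
for almost every time, so it also serves as the input of the switching strategies, which must be
predictable. -/

/-! ### Measurable selection up to null sets -/

/-- A continuous map on a compact set of sequences of natural numbers has a Borel right inverse on
its image. -/
theorem exists_measurable_rightInverse_of_isCompact {X : Type*} [TopologicalSpace X] [T2Space X]
    [MeasurableSpace X] [BorelSpace X] {h : (ℕ → ℕ) → X} (hh : Continuous h) {K : Set (ℕ → ℕ)}
    (hK : IsCompact K) :
    ∃ σ : X → ℕ → ℕ, Measurable σ ∧ ∀ p ∈ h '' K, σ p ∈ K ∧ h (σ p) = p := by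
  classical
  let good : ℕ → (X → List ℕ) → Prop := fun j w =>
    (∀ l, MeasurableSet {p | w p = l}) ∧ ∀ p ∈ h '' K, ∃ x ∈ K, h x = p ∧ PiNat.res x j = w p
  have hmeas : ∀ (j : ℕ) (l : List ℕ), MeasurableSet (h '' (K ∩ {x | PiNat.res x j = l})) := by
    intro j l
    have hcl : IsClosed {x : ℕ → ℕ | PiNat.res x j = l} := by
      by_cases hl : ∃ y : ℕ → ℕ, PiNat.res y j = l
      · obtain ⟨y, rfl⟩ := hl
        have : {x : ℕ → ℕ | PiNat.res x j = PiNat.res y j} = ⋂ i, ⋂ (_ : i < j), {x | x i = y i} := by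
          ext x
          simp only [mem_ofPred_eq, mem_iInter]
          rw [PiNat.res_eq_res]
        rw [this]
        exact isClosed_iInter fun i => isClosed_iInter fun _ =>
          isClosed_eq (continuous_apply i) continuous_const
      · have : {x : ℕ → ℕ | PiNat.res x j = l} = ∅ := by
          ext x
          simp only [mem_ofPred_eq, mem_empty_iff_false, iff_false]
          exact fun hx => hl ⟨x, hx⟩
        rw [this]
        exact isClosed_empty
    exact ((hK.inter_right hcl).image hh).isClosed.measurableSet
  -- The section is built digit by digit: the next digit is the least one for which the fibre over
  -- `p` still meets `K`, so the limit is the lexicographically least point of the fibre.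
  -- `PiNat.res` lists the latest digit first, hence the `::`.
  have step : ∀ j (w : {w // good j w}), ∃ a : X → ℕ, good (j + 1) (fun p => a p :: w.1 p) := by
    rintro j ⟨w, hw, hwK⟩
    -- The second alternative only makes the search succeed off the image.
    let pr : X → ℕ → Prop := fun p a => p ∈ h '' (K ∩ {x | PiNat.res x (j + 1) = a :: w p}) ∨ p ∉ h '' K
    have hex : ∀ p, ∃ a, pr p a := by
      intro p
      by_cases hp : p ∈ h '' K
      · obtain ⟨x, hx, hxp, hxw⟩ := hwK p hp
        exact ⟨x j, Or.inl ⟨x, ⟨hx, by rw [mem_ofPred_eq, PiNat.res_succ, hxw]⟩, hxp⟩⟩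
      · exact ⟨0, Or.inr hp⟩
    have hprm : ∀ a, MeasurableSet {p | pr p a} := by
      intro a
      have : {p | pr p a} = (⋃ l, {p | w p = l} ∩ h '' (K ∩ {x | PiNat.res x (j + 1) = a :: l}))
          ∪ (h '' K)ᶜ := by
        ext p
        simp only [pr, mem_union, mem_iUnion, mem_inter_iff, mem_ofPred_eq, mem_compl_iff]
        constructor
        · rintro (h1 | h1)
          · exact Or.inl ⟨w p, rfl, h1⟩
          · exact Or.inr h1
        · rintro (⟨l, rfl, h1⟩ | h1)
          · exact Or.inl h1
          · exact Or.inr h1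
      rw [this]
      exact (MeasurableSet.iUnion fun l => (hw l).inter (hmeas _ _)).union
        (hK.image hh).isClosed.measurableSet.compl
    have hfind := measurable_find hex hprm
    refine ⟨fun p => Nat.find (hex p), ?_, ?_⟩
    · intro l
      rcases l with _ | ⟨a, l⟩
      · simp
      · have : {p | Nat.find (hex p) :: w p = a :: l}
            = (fun p => Nat.find (hex p)) ⁻¹' {a} ∩ {p | w p = l} := by
          ext p; simp
        rw [this]
        exact (hfind (measurableSet_singleton a)).inter (hw l)
    · intro p hp
      rcases Nat.find_spec (hex p) with h1 | h1
      · obtain ⟨x, ⟨hx, hx'⟩, hxp⟩ := h1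
        exact ⟨x, hx, hxp, hx'⟩
      · exact absurd hp h1
  choose a ha using step
  let W : ∀ j, {w // good j w} := fun j => Nat.rec
    ⟨fun _ => [], fun l => by by_cases hl : [] = l <;> simp [hl], fun p hp => by
      obtain ⟨x, hx, hxp⟩ := hp
      exact ⟨x, hx, hxp, PiNat.res_zero x⟩⟩
    (fun j w => ⟨fun p => a j w p :: w.1 p, ha j w⟩) j
  have hW : ∀ j p, (W (j + 1)).1 p = a j (W j) p :: (W j).1 p := fun j p => rfl
  let σ : X → ℕ → ℕ := fun p j => a j (W j) p
  have hres : ∀ j p, PiNat.res (σ p) j = (W j).1 p := by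
    intro j p
    induction j with
    | zero => rfl
    | succ j ih => rw [PiNat.res_succ, ih, hW]
  refine ⟨σ, ?_, ?_⟩
  · refine measurable_pi_lambda _ fun j => measurable_to_countable' fun b => ?_
    have : (fun p => σ p j) ⁻¹' {b} = ⋃ l, {p | (W (j + 1)).1 p = b :: l} := by
      ext p
      simp only [mem_preimage, mem_singleton_iff, mem_iUnion, mem_ofPred_eq, hW, List.cons.injEq]
      exact ⟨fun hb => ⟨_, hb, rfl⟩, fun ⟨_, hb, _⟩ => hb⟩
    rw [this]
    exact MeasurableSet.iUnion fun l => (W (j + 1)).2.1 _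
  · intro p hp
    -- Each finite prefix of `σ p` extends to a point of the compact fibre; by Cantor's intersection
    -- theorem `σ p` itself lies in it.
    let F : ℕ → Set (ℕ → ℕ) := fun j => (K ∩ h ⁻¹' {p}) ∩ PiNat.cylinder (σ p) j
    have hKp : IsCompact (K ∩ h ⁻¹' {p}) := hK.inter_right (isClosed_singleton.preimage hh)
    have hcyl : ∀ j, IsClosed (PiNat.cylinder (σ p) j) := fun j => by
      rw [PiNat.cylinder_eq_pi]
      exact isClosed_set_pi fun _ _ => isClosed_singleton
    have hne : (⋂ j, F j).Nonempty := by
      refine IsCompact.nonempty_iInter_of_sequence_nonempty_isCompact_isClosed F ?_ ?_ ?_ ?_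
      · exact fun j => inter_subset_inter_right _ (PiNat.cylinder_anti _ (Nat.le_succ j))
      · intro j
        obtain ⟨x, hx, hxp, hxw⟩ := (W j).2.2 p hp
        refine ⟨x, ⟨hx, hxp⟩, ?_⟩
        rw [PiNat.cylinder_eq_res, mem_ofPred_eq, hxw, hres]
      · exact hKp.inter_right (hcyl 0)
      · exact fun j => (hKp.inter_right (hcyl j)).isClosed
    obtain ⟨x, hx⟩ := hne
    rw [mem_iInter] at hx
    have hxσ : x = σ p := by
      funext i
      exact PiNat.mem_cylinder_iff.1 (hx (i + 1)).2 i (Nat.lt_succ_self i)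
    exact hxσ ▸ (hx 0).1

/-- An open set that contains a compact box of sequences contains an elementary box. -/
theorem exists_nat_subset_of_box_subset {k : ℕ → ℕ} {V : Set (ℕ → ℕ)} (hV : IsOpen V)
    (hKV : {x : ℕ → ℕ | ∀ i, x i ≤ k i} ⊆ V) : ∃ j, {x : ℕ → ℕ | ∀ i < j, x i ≤ k i} ⊆ V := by
  have hK : IsCompact {x : ℕ → ℕ | ∀ i, x i ≤ k i} := by
    have : {x : ℕ → ℕ | ∀ i, x i ≤ k i} = pi univ fun i => Iic (k i) := by
      ext x; simp [Pi.le_def]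
    rw [this]
    exact isCompact_univ_pi fun i => (finite_Iic (k i)).isCompact
  have h1 : ∀ x : {x : ℕ → ℕ | ∀ i, x i ≤ k i}, ∃ m, PiNat.cylinder (x : ℕ → ℕ) m ⊆ V := by
    intro x
    obtain ⟨s, ⟨y, m, rfl⟩, hxs, hsV⟩ :=
      (PiNat.isTopologicalBasis_cylinders (fun _ => ℕ)).exists_subset_of_mem_open (hKV x.2) hV
    exact ⟨m, by rwa [PiNat.mem_cylinder_iff_eq.1 hxs]⟩
  choose m hm using h1
  obtain ⟨F, hF⟩ := hK.elim_finite_subcover (fun x : {x : ℕ → ℕ | ∀ i, x i ≤ k i} => PiNat.cylinder (x : ℕ → ℕ) (m x))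
    (fun x => PiNat.isOpen_cylinder _ _ _)
    (fun x hx => mem_iUnion.2 ⟨⟨x, hx⟩, PiNat.self_mem_cylinder _ _⟩)
  refine ⟨F.sup m, fun x hx => ?_⟩
  -- Truncating at `k` moves `x` into the box without changing its first `F.sup m` coordinates, and
  -- the covering cylinders see only these.
  have hx' : (fun i => min (x i) (k i)) ∈ {x : ℕ → ℕ | ∀ i, x i ≤ k i} := fun i => min_le_right _ _
  obtain ⟨y, hy⟩ := mem_iUnion.1 (hF hx')
  obtain ⟨hyF, hy⟩ := mem_iUnion.1 hy
  refine hm y (PiNat.mem_cylinder_iff.2 fun i hi => ?_)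
  rw [← PiNat.mem_cylinder_iff.1 hy i hi]
  exact (min_eq_left (hx i (hi.trans_le (Finset.le_sup hyF)))).symm

/-- The continuous image of the space of sequences is exhausted in measure by images of compact
boxes. -/
theorem exists_isCompact_le_measure_image {X : Type*} [TopologicalSpace X] [MeasurableSpace X]
    {ρ : Measure X} [ρ.OuterRegular] {h : (ℕ → ℕ) → X} (hh : Continuous h) {c : ℝ≥0∞}
    (hc : c < ρ (range h)) : ∃ K : Set (ℕ → ℕ), IsCompact K ∧ c ≤ ρ (h '' K) := by
  -- Coordinates are bounded one at a time without dropping to measure `c`. Continuity from below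
  -- along increasing unions needs no measurability of the images.
  have step : ∀ (E : Set (ℕ → ℕ)) (j : ℕ), c < ρ (h '' E) →
      ∃ b : ℕ, c < ρ (h '' (E ∩ {x | x j ≤ b})) := by
    intro E j hE
    have hu : h '' E = ⋃ b : ℕ, h '' (E ∩ {x | x j ≤ b}) := by
      rw [← image_iUnion, ← inter_iUnion]
      congr 1
      refine (inter_eq_left.2 fun x _ => mem_iUnion.2 ⟨x j, by simp⟩).symm
    have hmono : Monotone fun b : ℕ => h '' (E ∩ {x | x j ≤ b}) := fun b b' hb =>
      image_mono (inter_subset_inter_right _ fun x hx => le_trans hx hb)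
    rw [hu, hmono.measure_iUnion] at hE
    exact lt_iSup_iff.1 hE
  choose! b hb using step
  let E : ℕ → Set (ℕ → ℕ) := fun j => Nat.rec univ (fun j E => E ∩ {x | x j ≤ b E j}) j
  have hE : ∀ j, E (j + 1) = E j ∩ {x | x j ≤ b (E j) j} := fun j => rfl
  have hEc : ∀ j, c < ρ (h '' E j) := by
    intro j
    induction j with
    | zero => simpa [E] using hc
    | succ j ih => exact hb _ _ ih
  let k : ℕ → ℕ := fun j => b (E j) j
  have hEk : ∀ j, E j = {x : ℕ → ℕ | ∀ i < j, x i ≤ k i} := by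
    intro j
    induction j with
    | zero => simp [E]
    | succ j ih =>
      rw [hE]
      ext x
      simp only [mem_inter_iff, mem_ofPred_eq, Nat.lt_succ_iff_lt_or_eq]
      have := Set.ext_iff.1 ih x
      simp only [mem_ofPred_eq] at this
      rw [this]
      constructor
      · rintro ⟨h1, h2⟩ i (hi | rfl)
        · exact h1 i hi
        · exact h2
      · exact fun h1 => ⟨fun i hi => h1 i (Or.inl hi), h1 j (Or.inr rfl)⟩
  refine ⟨{x | ∀ i, x i ≤ k i}, ?_, ?_⟩
  · have : {x : ℕ → ℕ | ∀ i, x i ≤ k i} = pi univ fun i => Iic (k i) := by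
      ext x; simp [Pi.le_def]
    rw [this]
    exact isCompact_univ_pi fun i => (finite_Iic (k i)).isCompact
  · by_contra! hlt
    -- Continuity from above may fail for these images. Outer regularity replaces it: an open set of
    -- measure below `c` around the image of the box would already contain the image of some `E j`.
    obtain ⟨U, hU, hUo, hUc⟩ := Set.exists_isOpen_lt_of_lt _ _ hlt
    obtain ⟨j, hj⟩ := exists_nat_subset_of_box_subset (hUo.preimage hh) (image_subset_iff.1 hU)
    have h1 : ρ (h '' E j) ≤ ρ U := measure_mono (image_subset_iff.2 (hEk j ▸ hj))
    exact absurd (hEc j) (not_lt.2 (h1.trans hUc.le))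

/-- **Measurable selection**: a Borel set `B ⊆ X × Y` has a Borel section over its projection to `X`,
up to null sets of a given finite measure. -/
theorem exists_measurable_selection {X Y : Type*} [TopologicalSpace X] [PolishSpace X]
    [MeasurableSpace X] [BorelSpace X] [TopologicalSpace Y] [PolishSpace Y] [MeasurableSpace Y]
    [BorelSpace Y] [Nonempty Y] (ρ : Measure X) [IsFiniteMeasure ρ] {B : Set (X × Y)}
    (hB : MeasurableSet B) :
    ∃ (D : Set X) (g : X → Y), MeasurableSet D ∧ Measurable g ∧ (∀ x ∈ D, (x, g x) ∈ B) ∧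
      ρ (Prod.fst '' B \ D) = 0 := by
  classical
  have han := hB.analyticSet
  rw [AnalyticSet] at han
  rcases han with rfl | ⟨f, hf, hfB⟩
  · exact ⟨∅, fun _ => Classical.arbitrary Y, MeasurableSet.empty, measurable_const,
      fun x hx => absurd hx (notMem_empty x), by simp⟩
  let _ := TopologicalSpace.upgradeIsCompletelyMetrizable X
  have hh : Continuous (fun x => (f x).1) := continuous_fst.comp hf
  have hproj : Prod.fst '' B = range (fun x => (f x).1) := by
    rw [← hfB, ← range_comp]; rfl
  rw [hproj]
  set R := range (fun x => (f x).1) with hR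
  have hfin : ρ R ≠ ∞ := measure_ne_top ρ R
  -- A Borel set is analytic, so its projection is a continuous image of the sequence space; compact
  -- pieces of that space carry Borel sections and miss at most `1 / (k + 1)` of the measure.
  have key : ∀ k : ℕ, ∃ (D : Set X) (g : X → Y), MeasurableSet D ∧ D ⊆ R ∧ Measurable g ∧
      (∀ x ∈ D, (x, g x) ∈ B) ∧ ρ R ≤ ρ D + (k + 1 : ℝ≥0∞)⁻¹ := by
    intro k
    obtain ⟨K, hK, hKR⟩ : ∃ K : Set (ℕ → ℕ), IsCompact K ∧
        ρ R - (k + 1 : ℝ≥0∞)⁻¹ ≤ ρ ((fun x => (f x).1) '' K) := by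
      by_cases h0 : ρ R = 0
      · exact ⟨∅, isCompact_empty, by simp [h0]⟩
      · refine exists_isCompact_le_measure_image hh (ENNReal.sub_lt_self hfin h0 ?_)
        exact ENNReal.inv_ne_zero.2 (by finiteness)
    obtain ⟨σ, hσ, hσK⟩ := exists_measurable_rightInverse_of_isCompact hh hK
    refine ⟨(fun x => (f x).1) '' K, fun x => (f (σ x)).2, (hK.image hh).isClosed.measurableSet,
      image_subset_range _ _, (continuous_snd.comp hf).measurable.comp hσ, fun x hx => ?_,
      tsub_le_iff_right.1 hKR⟩
    rw [← hfB]
    exact ⟨σ x, Prod.ext (hσK x hx).2 rfl⟩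
  choose D g hD hDR hg hgB hDρ using key
  -- The partial sections are glued by using the first one defined at `x`.
  let g' : X → Y := fun x => if hx : ∃ k, x ∈ D k then g (Nat.find hx) x else Classical.arbitrary Y
  refine ⟨⋃ k, D k, g', MeasurableSet.iUnion hD, ?_, ?_, ?_⟩
  · have hpr : ∀ x, ∃ k, x ∈ D k ∨ x ∉ ⋃ k, D k := by
      intro x
      by_cases hx : x ∈ ⋃ k, D k
      · obtain ⟨k, hk⟩ := mem_iUnion.1 hx
        exact ⟨k, Or.inl hk⟩
      · exact ⟨0, Or.inr hx⟩
    have hfind : Measurable fun x => Nat.find (hpr x) := measurable_find hpr fun k =>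
      (hD k).union (MeasurableSet.iUnion hD).compl
    have hG : Measurable fun z : ℕ × X => g z.1 z.2 := measurable_from_prod_countable_right hg
    have heq : g' = fun x => if x ∈ ⋃ k, D k then g (Nat.find (hpr x)) x else Classical.arbitrary Y := by
      funext x
      by_cases hx : ∃ k, x ∈ D k
      · have hx' : x ∈ ⋃ k, D k := mem_iUnion.2 hx
        simp only [g', dif_pos hx, if_pos hx']
        congr 1
        simp [hx']
      · have hx' : x ∉ ⋃ k, D k := fun h1 => hx (mem_iUnion.1 h1)
        simp only [g', dif_neg hx, if_neg hx']
    rw [heq]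
    exact Measurable.ite (MeasurableSet.iUnion hD) (hG.comp (hfind.prodMk measurable_id))
      measurable_const
  · intro x hx
    have hx' := mem_iUnion.1 hx
    simp only [g', dif_pos hx']
    exact hgB _ x (Nat.find_spec hx')
  · have hle : ρ R ≤ ρ (⋃ k, D k) := by
      refine ENNReal.le_of_forall_pos_le_add fun ε hε _ => ?_
      obtain ⟨k, hk⟩ := ENNReal.exists_inv_nat_lt (ENNReal.coe_pos.2 hε).ne'
      refine (hDρ k).trans (add_le_add (measure_mono (subset_iUnion D k)) (le_trans ?_ hk.le))
      exact ENNReal.inv_le_inv.2 le_self_add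
    rw [measure_sdiff (iUnion_subset hDR) (MeasurableSet.iUnion hD).nullMeasurableSet
      (measure_ne_top _ _)]
    exact tsub_eq_zero_of_le hle

/-! ### The extended integral -/

theorem extIntegral_map {α β : Type*} {_ : MeasurableSpace α} {_ : MeasurableSpace β} {ν : Measure α}
    {g : α → β} (hg : Measurable g) {f : β → EReal} (hf : Measurable f) :
    extIntegral (ν.map g) f = extIntegral ν (fun x => f (g x)) := by
  unfold extIntegral
  rw [lintegral_map (by fun_prop) hg, lintegral_map (by fun_prop) hg]

theorem extIntegral_coe {α : Type*} {_ : MeasurableSpace α} {ν : Measure α} {a : α → ℝ}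
    (ha : Integrable a ν) : extIntegral ν (fun x => (a x : EReal)) = ((∫ x, a x ∂ν : ℝ) : EReal) := by
  have h1 : ∫⁻ x, ENNReal.ofReal (a x) ∂ν ≠ ∞ := ha.lintegral_lt_top.ne
  have h2 : ∫⁻ x, ENNReal.ofReal (-a x) ∂ν ≠ ∞ := ha.neg.lintegral_lt_top.ne
  rw [integral_eq_lintegral_pos_part_sub_lintegral_neg_part ha, EReal.coe_sub,
    EReal.coe_ennreal_toReal h1, EReal.coe_ennreal_toReal h2]
  rfl

theorem coe_integral_le_extIntegral {α : Type*} {_ : MeasurableSpace α} {ν : Measure α} {a : α → ℝ}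
    (ha : Integrable a ν) {b : α → EReal} (hab : ∀ᵐ x ∂ν, (a x : EReal) ≤ b x) :
    ((∫ x, a x ∂ν : ℝ) : EReal) ≤ extIntegral ν b := by
  rw [← extIntegral_coe ha]
  refine EReal.sub_le_sub ?_ ?_
  · exact EReal.coe_ennreal_le_coe_ennreal_iff.2
      (lintegral_mono_ae (hab.mono fun x hx => EReal.toENNReal_le_toENNReal hx))
  · exact EReal.coe_ennreal_le_coe_ennreal_iff.2
      (lintegral_mono_ae (hab.mono fun x hx => EReal.toENNReal_le_toENNReal (EReal.neg_le_neg_iff.2 hx)))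

theorem continuous_toENNReal_neg : Continuous fun x : EReal => (-x).toENNReal :=
  EReal.continuous_toENNReal.comp continuous_neg

/-- Monotone convergence for the extended integral. -/
theorem extIntegral_iSup {α : Type*} {_ : MeasurableSpace α} {ν : Measure α} {a : ℕ → α → ℝ}
    (ha : ∀ k, Integrable (a k) ν) (hmono : ∀ᵐ x ∂ν, Monotone fun k => a k x) {b : α → EReal}
    (hb : ∀ᵐ x ∂ν, b x = ⨆ k, (a k x : EReal)) :
    extIntegral ν b = ⨆ k, ((∫ x, a k x ∂ν : ℝ) : EReal) := by
  have hI : Monotone fun k => ((∫ x, a k x ∂ν : ℝ) : EReal) := fun k l hkl =>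
    EReal.coe_le_coe_iff.2 (integral_mono_ae (ha k) (ha l) (hmono.mono fun x hx => hx hkl))
  have hlim : ∀ᵐ x ∂ν, Tendsto (fun k => (a k x : EReal)) atTop (𝓝 (b x)) := by
    filter_upwards [hmono, hb] with x h1 h2
    rw [h2]
    exact tendsto_atTop_iSup fun k l hkl => EReal.coe_le_coe_iff.2 (h1 hkl)
  refine tendsto_nhds_unique ?_ (tendsto_atTop_iSup hI)
  have hpos : Tendsto (fun k => ∫⁻ x, ENNReal.ofReal (a k x) ∂ν) atTop
      (𝓝 (∫⁻ x, (b x).toENNReal ∂ν)) := by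
    refine lintegral_tendsto_of_tendsto_of_monotone (fun k => (ha k).aemeasurable.ennreal_ofReal) ?_ ?_
    · exact hmono.mono fun x hx k l hkl => ENNReal.ofReal_le_ofReal (hx hkl)
    · exact hlim.mono fun x hx => (EReal.continuous_toENNReal.tendsto _).comp hx
  -- Negative parts decrease, so they are dominated by that of the integrable `a 0`.
  have hneg : Tendsto (fun k => ∫⁻ x, ENNReal.ofReal (-a k x) ∂ν) atTop
      (𝓝 (∫⁻ x, (-b x).toENNReal ∂ν)) := by
    refine tendsto_lintegral_of_dominated_convergence' (fun x => ENNReal.ofReal (-a 0 x))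
      (fun k => (ha k).neg.aemeasurable.ennreal_ofReal) ?_ (ha 0).neg.lintegral_lt_top.ne ?_
    · exact fun k => hmono.mono fun x hx => ENNReal.ofReal_le_ofReal (neg_le_neg (hx (Nat.zero_le k)))
    · exact hlim.mono fun x hx => (continuous_toENNReal_neg.tendsto _).comp hx
  -- Finiteness of this integral excludes `∞ - ∞` and makes the difference continuous at the limit.
  have hnegfin : ∫⁻ x, (-b x).toENNReal ∂ν ≠ ∞ := by
    refine ne_top_of_le_ne_top (ha 0).neg.lintegral_lt_top.ne (lintegral_mono_ae ?_)
    filter_upwards [hb] with x hx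
    have : (a 0 x : EReal) ≤ b x := hx ▸ le_iSup (fun k => (a k x : EReal)) 0
    exact EReal.toENNReal_le_toENNReal (EReal.neg_le_neg_iff.2 this)
  have heq : ∀ k, ((∫ x, a k x ∂ν : ℝ) : EReal) = ((∫⁻ x, ENNReal.ofReal (a k x) ∂ν : ℝ≥0∞) : EReal)
      + -((∫⁻ x, ENNReal.ofReal (-a k x) ∂ν : ℝ≥0∞) : EReal) := fun k => (extIntegral_coe (ha k)).symm
  simp_rw [heq]
  have hc := EReal.continuousAt_add (p := (((∫⁻ x, (b x).toENNReal ∂ν : ℝ≥0∞) : EReal),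
    -((∫⁻ x, (-b x).toENNReal ∂ν : ℝ≥0∞) : EReal))) (Or.inr ?_) (Or.inl ?_)
  · exact hc.tendsto.comp ((continuous_coe_ennreal_ereal.tendsto _ |>.comp hpos).prodMk_nhds
      ((continuous_neg.tendsto _).comp ((continuous_coe_ennreal_ereal.tendsto _).comp hneg)))
  · simpa using hnegfin
  · simp

/-! ### Conditional expectations given a state -/

section Conditional

variable {Ω β : Type*} {mΩ : MeasurableSpace Ω} {mβ : MeasurableSpace β} {μ : Measure Ω}
  [IsProbabilityMeasure μ] {S : Ω → β}

theorem ae_integrable_condDistrib_comp (hS : Measurable S) {E : Type*} [MeasurableSpace E]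
    [StandardBorelSpace E] [Nonempty E] {W : Ω → E} (hW : AEMeasurable W μ) {g : E → ℝ}
    (hg : Measurable g) (hi : Integrable (fun ω => g (W ω)) μ) :
    ∀ᵐ z ∂μ.map S, Integrable g (condDistrib W S μ z) := by
  refine Integrable.condDistrib_ae_map (f := fun x => g x.2) hW ?_
  exact (integrable_map_measure (hg.comp measurable_snd).aestronglyMeasurable
    (hS.aemeasurable.prodMk hW)).2 hi

theorem ae_ae_condDistrib (hS : Measurable S) {E : Type*} [MeasurableSpace E]
    [StandardBorelSpace E] [Nonempty E] {W : Ω → E} (hW : AEMeasurable W μ) {p : E → Prop}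
    (hp : MeasurableSet {w | p w}) (h : ∀ᵐ ω ∂μ, p (W ω)) :
    ∀ᵐ z ∂μ.map S, ∀ᵐ w ∂condDistrib W S μ z, p w := by
  refine Measure.ae_ae_of_ae_compProd (p := fun x => p x.2) ?_
  rw [compProd_map_condDistrib hW]
  exact (ae_map_iff (p := fun x : β × E => p x.2) (hS.aemeasurable.prodMk hW)
    (hp.preimage measurable_snd)).2 h

/-- Two separate conditional laws cannot be compared pointwise. Both are marginals of the
conditional law of the pair, which is concentrated on the pairs in the right order. -/
theorem coe_integral_condDistrib_le (hS : Measurable S) {ρ : Ω → ℝ} (hρ : Integrable ρ μ)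
    {Φ : Ω → EReal} (hΦ : AEMeasurable Φ μ) (hle : ∀ᵐ ω ∂μ, (ρ ω : EReal) ≤ Φ ω) :
    ∀ᵐ z ∂μ.map S, ((∫ y, y ∂condDistrib ρ S μ z : ℝ) : EReal)
      ≤ extIntegral (condDistrib Φ S μ z) (fun y => y) := by
  have hW : AEMeasurable (fun ω => (ρ ω, Φ ω)) μ := hρ.aemeasurable.prodMk hΦ
  have h1 := condDistrib_comp (mβ := mβ) S hW (measurable_fst (α := ℝ) (β := EReal))
  have h2 := condDistrib_comp (mβ := mβ) S hW (measurable_snd (α := ℝ) (β := EReal))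
  filter_upwards [h1, h2, ae_integrable_condDistrib_comp hS hW measurable_fst hρ,
    ae_ae_condDistrib (p := fun w => (w.1 : EReal) ≤ w.2) hS hW
      (measurableSet_le (by fun_prop) (by fun_prop)) hle] with z h1 h2 h3 h4
  change condDistrib ρ S μ z = _ at h1
  change condDistrib Φ S μ z = _ at h2
  rw [h1, h2, Kernel.map_apply _ measurable_fst, Kernel.map_apply _ measurable_snd,
    extIntegral_map measurable_snd measurable_id',
    integral_map measurable_fst.aemeasurable measurable_id'.aestronglyMeasurable]
  exact coe_integral_le_extIntegral h3 h4

/-- The conditional law of the whole sequence puts all `ρ k` and their supremum on one space, where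
monotone convergence applies for almost every state. -/
theorem extIntegral_condDistrib_iSup (hS : Measurable S) {ρ : ℕ → Ω → ℝ}
    (hρ : ∀ k, Integrable (ρ k) μ) (hmono : ∀ᵐ ω ∂μ, Monotone fun k => ρ k ω) {Φ : Ω → EReal}
    (hΦ : ∀ᵐ ω ∂μ, Φ ω = ⨆ k, (ρ k ω : EReal)) :
    ∀ᵐ z ∂μ.map S, extIntegral (condDistrib Φ S μ z) (fun y => y)
      = ⨆ k, ((∫ y, y ∂condDistrib (ρ k) S μ z : ℝ) : EReal) := by
  have hW : AEMeasurable (fun ω k => ρ k ω) μ := aemeasurable_pi_lambda _ fun k => (hρ k).aemeasurable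
  have hsup : Measurable fun w : ℕ → ℝ => ⨆ k, (w k : EReal) :=
    Measurable.iSup fun k => (measurable_pi_apply k).coe_real_ereal
  have hev : ∀ k : ℕ, Measurable fun w : ℕ → ℝ => w k := fun k => measurable_pi_apply k
  have h1 := fun k => condDistrib_comp (mβ := mβ) S hW (hev k)
  have h2 := condDistrib_comp (mβ := mβ) S hW hsup
  have hmm : MeasurableSet {w : ℕ → ℝ | Monotone w} := by
    have : {w : ℕ → ℝ | Monotone w} = ⋂ k, {w | w k ≤ w (k + 1)} := by
      ext w
      simp only [mem_ofPred_eq, mem_iInter]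
      exact ⟨fun h k => h (Nat.le_succ k), monotone_nat_of_le_succ⟩
    rw [this]
    exact MeasurableSet.iInter fun k => measurableSet_le (hev _) (hev _)
  have hΦ' : condDistrib Φ S μ = condDistrib ((fun w : ℕ → ℝ => ⨆ k, (w k : EReal)) ∘
      fun ω k => ρ k ω) S μ := condDistrib_congr_left hΦ
  filter_upwards [ae_all_iff.2 h1, h2,
    ae_all_iff.2 fun k => ae_integrable_condDistrib_comp hS hW (hev k) (hρ k),
    ae_ae_condDistrib hS hW hmm hmono] with z h1 h2 h3 h4
  rw [hΦ', h2, Kernel.map_apply _ hsup, extIntegral_map hsup measurable_id']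
  have h1' : ∀ k, ∫ y, y ∂condDistrib (ρ k) S μ z = ∫ w, w k ∂condDistrib (fun ω k => ρ k ω) S μ z := by
    intro k
    have := h1 k
    change condDistrib (ρ k) S μ z = _ at this
    rw [this, Kernel.map_apply _ (hev k),
      integral_map (hev k).aemeasurable measurable_id'.aestronglyMeasurable]
  simp_rw [h1']
  exact extIntegral_iSup h3 h4 (Eventually.of_forall fun w => rfl)

/-- The mean of the conditional law of `Y` given `S` is identified by the expectations of `Y` on the
events of `σ(S)` on which `Y` is integrable. -/
theorem integral_condDistrib_eq_add (hS : Measurable S) {Y ρ : Ω → ℝ} (hY : AEMeasurable Y μ)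
    (hρ : Integrable ρ μ) {c : β → ℝ} (hc : Measurable c) {D : ℕ → Set β}
    (hD : ∀ m, MeasurableSet (D m)) (hDu : ∀ z, ∃ m, z ∈ D m)
    (hYi : ∀ m, IntegrableOn Y (S ⁻¹' D m) μ) (hci : ∀ m, IntegrableOn (fun ω => c (S ω)) (S ⁻¹' D m) μ)
    (hset : ∀ m, ∀ B ⊆ D m, MeasurableSet B →
      ∫ ω in S ⁻¹' B, Y ω ∂μ = ∫ ω in S ⁻¹' B, (c (S ω) + ρ ω) ∂μ) :
    ∀ᵐ z ∂μ.map S, ∫ y, y ∂condDistrib Y S μ z = c z + ∫ y, y ∂condDistrib ρ S μ z := by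
  have hm : ∀ m, ∀ᵐ z ∂μ.map S, z ∈ D m →
      ∫ y, y ∂condDistrib Y S μ z = c z + ∫ y, y ∂condDistrib ρ S μ z := by
    intro m
    have hDm := hD m
    -- `Y` need not be integrable globally. Cutting off by a function of the state makes it so, and
    -- on `D m` the cut-off is invisible to the conditional law.
    let f : β × ℝ → ℝ := fun x => (D m).indicator (fun _ => 1) x.1 * x.2
    let g : β × ℝ → ℝ := fun x => (D m).indicator (fun _ => 1) x.1 * (c x.1 + x.2)
    have hind : Measurable ((D m).indicator fun _ => (1 : ℝ)) := measurable_const.indicator hDm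
    have hf : StronglyMeasurable f :=
      ((hind.comp measurable_fst).mul measurable_snd).stronglyMeasurable
    have hg : StronglyMeasurable g := ((hind.comp measurable_fst).mul
      ((hc.comp measurable_fst).add measurable_snd)).stronglyMeasurable
    have hf_eq : (fun ω => f (S ω, Y ω)) = (S ⁻¹' D m).indicator Y := by
      funext ω
      by_cases h : S ω ∈ D m <;> simp [f, h]
    have hg_eq : (fun ω => g (S ω, ρ ω)) = (S ⁻¹' D m).indicator fun ω => c (S ω) + ρ ω := by
      funext ω
      by_cases h : S ω ∈ D m <;> simp [g, h]
    have hfi : Integrable (fun ω => f (S ω, Y ω)) μ := by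
      rw [hf_eq]; exact (hYi m).integrable_indicator (hS hDm)
    have hgi : Integrable (fun ω => g (S ω, ρ ω)) μ := by
      rw [hg_eq]; exact ((hci m).add hρ.integrableOn).integrable_indicator (hS hDm)
    have e1 := condExp_prod_ae_eq_integral_condDistrib hS hY hf hfi
    have e2 := condExp_prod_ae_eq_integral_condDistrib hS hρ.aemeasurable hg hgi
    have e3 : μ[fun ω => f (S ω, Y ω) | mβ.comap S] =ᵐ[μ] μ[fun ω => g (S ω, ρ ω) | mβ.comap S] := by
      refine ae_eq_condExp_of_forall_setIntegral_eq hS.comap_le hgi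
        (fun _ _ _ => integrable_condExp.integrableOn) ?_ stronglyMeasurable_condExp.aestronglyMeasurable
      rintro _ ⟨B, hB, rfl⟩ -
      rw [setIntegral_condExp hS.comap_le hfi ⟨B, hB, rfl⟩, hf_eq, hg_eq,
        setIntegral_indicator (hS hDm), setIntegral_indicator (hS hDm), ← preimage_inter]
      exact hset m _ inter_subset_right (hB.inter hDm)
    have e4 : ∀ᵐ z ∂μ.map S, ∫ y, f (z, y) ∂condDistrib Y S μ z = ∫ y, g (z, y) ∂condDistrib ρ S μ z := by
      rw [ae_map_iff hS.aemeasurable]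
      · filter_upwards [e1, e2, e3] with ω h1 h2 h3
        rw [← h1, ← h2, h3]
      · exact measurableSet_eq_fun hf.integral_condDistrib.measurable hg.integral_condDistrib.measurable
    filter_upwards [e4, ae_integrable_condDistrib_comp hS hρ.aemeasurable measurable_id hρ]
      with z hz hint hzD
    have hint' : Integrable (fun y : ℝ => y) (condDistrib ρ S μ z) := hint
    simp only [f, g, indicator_of_mem hzD, one_mul] at hz
    rw [hz, integral_add (integrable_const _) hint']
    simp
  filter_upwards [ae_all_iff.2 hm] with z hz
  obtain ⟨m, hzm⟩ := hDu z
  exact hz m hzm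

end Conditional

/-! ### The expected profit rate and nearly optimal strategies -/

/-- The expected profit rate `∑ λ_i(p, v) (v_i - p_i)` at the price vector `v`. -/
noncomputable def profitRate {n : ℕ} (lam : Fin n → Cube n → Cube n → ℝ≥0∞) (p v : Cube n) : ℝ :=
  ∑ i, (lam i p v).toReal * ((v i : ℝ) - (p i : ℝ))

section Control

variable {n : ℕ} {lam : Fin n → Cube n → Cube n → ℝ≥0∞}

theorem measurable_profitRate (hlam : ∀ i, Measurable fun z : Cube n × Cube n => lam i z.1 z.2) :
    Measurable fun z : Cube n × Cube n => profitRate lam z.1 z.2 := by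
  refine Finset.measurable_sum _ fun i _ => (hlam i).ennreal_toReal.mul (Measurable.sub ?_ ?_)
  · exact measurable_subtype_coe.comp ((measurable_pi_apply i).comp measurable_snd)
  · exact measurable_subtype_coe.comp ((measurable_pi_apply i).comp measurable_fst)

theorem abs_unitInterval_sub_le (a b : unitInterval) : |(a : ℝ) - b| ≤ 1 := by
  rw [abs_le]
  constructor <;> linarith [a.2.1, a.2.2, b.2.1, b.2.2]

theorem abs_profitRate_le (p v : Cube n) : |profitRate lam p v| ≤ ∑ i, (lam i p v).toReal := by
  refine (Finset.abs_sum_le_sum_abs _ _).trans (Finset.sum_le_sum fun i _ => ?_)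
  rw [abs_mul, abs_of_nonneg ENNReal.toReal_nonneg]
  exact mul_le_of_le_one_right ENNReal.toReal_nonneg (abs_unitInterval_sub_le _ _)

theorem profitRate_le_staticValue {p v : Cube n} (h : ∀ i, lam i p v ≠ ∞) :
    (profitRate lam p v : EReal) ≤ staticValue lam p :=
  le_iSup₂ (f := fun (v : Cube n) (_ : ∀ i, lam i p v ≠ ∞) => (profitRate lam p v : EReal)) v h

variable {Ω : Type*} {mΩ : MeasurableSpace Ω} {μ : Measure Ω} {θ : Measure ℝ≥0}
  {P u : CubeProcess Ω n}

theorem integrable_toReal_rate [IsProbabilityMeasure μ] [IsFiniteMeasure θ]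
    (hlam : ∀ i, Measurable fun z : Cube n × Cube n => lam i z.1 z.2)
    (hP : AEMeasurable (fun z : Ω × ℝ≥0 => P z.2 z.1) (μ.prod θ))
    (hu : AEMeasurable (fun z : Ω × ℝ≥0 => u z.2 z.1) (μ.prod θ)) {i : Fin n}
    (hfin : ∫⁻ z, lam i (P z.2 z.1) (u z.2 z.1) ∂μ.prod θ ≠ ∞) :
    Integrable (fun z : Ω × ℝ≥0 => (lam i (P z.2 z.1) (u z.2 z.1)).toReal) (μ.prod θ) :=
  integrable_toReal_of_lintegral_ne_top ((hlam i).comp_aemeasurable (hP.prodMk hu)) hfin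

theorem integrable_profitRate [IsProbabilityMeasure μ] [IsFiniteMeasure θ]
    (hlam : ∀ i, Measurable fun z : Cube n × Cube n => lam i z.1 z.2)
    (hP : AEMeasurable (fun z : Ω × ℝ≥0 => P z.2 z.1) (μ.prod θ))
    (hu : AEMeasurable (fun z : Ω × ℝ≥0 => u z.2 z.1) (μ.prod θ))
    (hfin : ∀ i, ∫⁻ z, lam i (P z.2 z.1) (u z.2 z.1) ∂μ.prod θ ≠ ∞) :
    Integrable (fun z : Ω × ℝ≥0 => profitRate lam (P z.2 z.1) (u z.2 z.1)) (μ.prod θ) := by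
  refine Integrable.mono' (g := fun z => ∑ i, (lam i (P z.2 z.1) (u z.2 z.1)).toReal)
    (integrable_finsetSum _ fun i _ => integrable_toReal_rate hlam hP hu (hfin i))
    ((measurable_profitRate hlam).comp_aemeasurable (hP.prodMk hu)).aestronglyMeasurable ?_
  exact Eventually.of_forall fun z => abs_profitRate_le _ _

/-- There are Borel candidates for the price vector which attain the static value. -/
theorem exists_measurable_candidates
    (hlam : ∀ i, Measurable fun z : Cube n × Cube n => lam i z.1 z.2)
    (ν : Measure (Cube n)) [IsFiniteMeasure ν] :
    ∃ (D : ℕ → Set (Cube n)) (g : ℕ → Cube n → Cube n) (b : ℕ → ℕ), (∀ j, MeasurableSet (D j)) ∧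
      (∀ j, Measurable (g j)) ∧ (∀ j, ∀ p ∈ D j, ∀ i, lam i p (g j p) ≤ b j) ∧
      ∀ᵐ p ∂ν, ∀ v, (∀ i, lam i p v ≠ ∞) → ∀ c < profitRate lam p v,
        ∃ j, p ∈ D j ∧ c < profitRate lam p (g j p) := by
  -- One selection for each rational profit level and integer rate bound. The bound on the rates is
  -- what later keeps the expected number of bets finite.
  let B : ℚ × ℕ → Set (Cube n × Cube n) := fun q =>
    {z | (∀ i, lam i z.1 z.2 ≤ q.2) ∧ (q.1 : ℝ) < profitRate lam z.1 z.2}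
  have hB : ∀ q, MeasurableSet (B q) := fun q => by
    have : B q = (⋂ i, {z | lam i z.1 z.2 ≤ q.2}) ∩ {z | (q.1 : ℝ) < profitRate lam z.1 z.2} := by
      ext z
      simp [B]
    rw [this]
    exact (MeasurableSet.iInter fun i => measurableSet_le (hlam i) measurable_const).inter
      (measurableSet_lt measurable_const (measurable_profitRate hlam))
  choose D g hD hg hgB hν using fun q => exists_measurable_selection ν (hB q)
  obtain ⟨e, he⟩ := exists_surjective_nat (ℚ × ℕ)
  refine ⟨fun j => D (e j), fun j => g (e j), fun j => (e j).2, fun j => hD _, fun j => hg _,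
    fun j p hp => (hgB _ p hp).1, ?_⟩
  have hae : ∀ᵐ p ∂ν, ∀ q, p ∉ Prod.fst '' B q \ D q :=
    ae_all_iff.2 fun q => measure_eq_zero_iff_ae_notMem.1 (hν q)
  filter_upwards [hae] with p hp v hv c hc
  obtain ⟨r, hcr, hr⟩ := exists_rat_btwn hc
  obtain ⟨m, hm⟩ : ∃ m : ℕ, ∀ i, lam i p v ≤ m := by
    obtain ⟨m, hm⟩ := ENNReal.exists_nat_gt (ENNReal.sum_ne_top.2 fun i (_ : i ∈ Finset.univ) => hv i)
    exact ⟨m, fun i => (Finset.single_le_sum (f := fun i => lam i p v)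
      (fun _ _ => zero_le) (Finset.mem_univ i)).trans hm.le⟩
  obtain ⟨j, hj⟩ := he (r, m)
  have hpD : p ∈ D (r, m) := by
    by_contra hn
    exact hp (r, m) ⟨⟨(p, v), ⟨hm, hr⟩, rfl⟩, hn⟩
  exact ⟨j, by rwa [hj], by rw [hj]; exact hcr.trans (hgB _ p hpD).2⟩

/-- A class of strategies which is stable under Borel functions of the strategy and of a version `R`
of `P` contains a sequence of strategies with finite expected numbers of bets, whose profit rates
increase to the static value. -/
theorem exists_strategies_tendsto_staticValue [IsProbabilityMeasure μ] [IsFiniteMeasure θ]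
    (hlam : ∀ i, Measurable fun z : Cube n × Cube n => lam i z.1 z.2) {R : CubeProcess Ω n}
    (hR : AEMeasurable (fun z : Ω × ℝ≥0 => R z.2 z.1) (μ.prod θ))
    (hRP : ∀ᵐ z ∂μ.prod θ, R z.2 z.1 = P z.2 z.1) {𝒞 : Set (CubeProcess Ω n)}
    (h𝒞 : ∀ u ∈ 𝒞, ∀ G : Cube n × Cube n → Cube n, Measurable G →
      (fun s ω => G (R s ω, u s ω)) ∈ 𝒞)
    {u₀ : CubeProcess Ω n} (hu₀ : u₀ ∈ 𝒞)
    (hfin : ∀ i, ∫⁻ z, lam i (P z.2 z.1) (u₀ z.2 z.1) ∂μ.prod θ ≠ ∞)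
    (hm₀ : AEMeasurable (fun z : Ω × ℝ≥0 => u₀ z.2 z.1) (μ.prod θ)) :
    ∃ u : ℕ → CubeProcess Ω n,
      (∀ k, u k ∈ 𝒞 ∧ ∀ i, ∫⁻ z, lam i (P z.2 z.1) (u k z.2 z.1) ∂μ.prod θ ≠ ∞) ∧
      ∀ᵐ z ∂μ.prod θ, (Monotone fun k => profitRate lam (P z.2 z.1) (u k z.2 z.1)) ∧
        staticValue lam (P z.2 z.1) = ⨆ k, (profitRate lam (P z.2 z.1) (u k z.2 z.1) : EReal) := by
  classical
  obtain ⟨D, g, b, hD, hg, hb, hsel⟩ :=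
    exists_measurable_candidates hlam ((μ.prod θ).map fun z : Ω × ℝ≥0 => R z.2 z.1)
  -- Use the `k`-th candidate where it is available and at least as profitable, otherwise keep the
  -- current price.
  let G : ℕ → Cube n × Cube n → Cube n := fun k z =>
    if z.1 ∈ D k ∧ profitRate lam z.1 z.2 ≤ profitRate lam z.1 (g k z.1) then g k z.1 else z.2
  have hG : ∀ k, Measurable (G k) := fun k => by
    refine Measurable.ite ((measurable_fst (hD k)).inter ?_) ((hg k).comp measurable_fst)
      measurable_snd
    exact measurableSet_le (measurable_profitRate hlam) ((measurable_profitRate hlam).comp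
      (measurable_fst.prodMk ((hg k).comp measurable_fst)))
  let u : ℕ → CubeProcess Ω n := fun k => Nat.rec u₀ (fun k v s ω => G k (R s ω, v s ω)) k
  have hu : ∀ k s ω, u (k + 1) s ω = G k (R s ω, u k s ω) := fun k s ω => rfl
  -- A switch costs at most the constant `b k`, which is integrable because `μ.prod θ` is finite.
  have hrate : ∀ k p v i, lam i p (G k (p, v)) ≤ b k + lam i p v := by
    intro k p v i
    by_cases h : p ∈ D k ∧ profitRate lam p v ≤ profitRate lam p (g k p)
    · simp only [G, if_pos h]
      exact (hb k p h.1 i).trans le_self_add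
    · simp only [G, if_neg h]
      exact le_add_self
  have hprofit : ∀ k p v, profitRate lam p v ≤ profitRate lam p (G k (p, v)) := by
    intro k p v
    by_cases h : p ∈ D k ∧ profitRate lam p v ≤ profitRate lam p (g k p)
    · simp only [G, if_pos h, h.2]
    · simp only [G, if_neg h, le_rfl]
  have hprofit' : ∀ k p v, p ∈ D k → profitRate lam p (g k p) ≤ profitRate lam p (G k (p, v)) := by
    intro k p v hp
    by_cases h : profitRate lam p v ≤ profitRate lam p (g k p)
    · simp only [G, if_pos (And.intro hp h), le_rfl]
    · simp only [G, hp, h, and_false, if_false]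
      exact (not_le.1 h).le
  have hadm : ∀ k, u k ∈ 𝒞 ∧ ∀ i, ∫⁻ z, lam i (P z.2 z.1) (u k z.2 z.1) ∂μ.prod θ ≠ ∞ := by
    intro k
    induction k with
    | zero => exact ⟨hu₀, hfin⟩
    | succ k ih =>
      refine ⟨h𝒞 _ ih.1 _ (hG k), fun i => ?_⟩
      have hle : ∫⁻ z, lam i (P z.2 z.1) (u (k + 1) z.2 z.1) ∂μ.prod θ
          ≤ ∫⁻ z, (b k + lam i (P z.2 z.1) (u k z.2 z.1)) ∂μ.prod θ := by
        refine lintegral_mono_ae ?_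
        filter_upwards [hRP] with z hz
        rw [hu, hz]
        exact hrate _ _ _ _
      refine ne_top_of_le_ne_top ?_ hle
      rw [lintegral_add_left measurable_const]
      refine ENNReal.add_ne_top.2 ⟨?_, ih.2 i⟩
      rw [lintegral_const]
      finiteness
  refine ⟨u, hadm, ?_⟩
  have hsel' := ae_of_ae_map hR hsel
  have hP : AEMeasurable (fun z : Ω × ℝ≥0 => P z.2 z.1) (μ.prod θ) := hR.congr hRP
  have hfin' : ∀ᵐ z ∂μ.prod θ, ∀ i, lam i (P z.2 z.1) (u₀ z.2 z.1) < ∞ := ae_all_iff.2 fun i =>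
    ae_lt_top' ((hlam i).comp_aemeasurable (hP.prodMk hm₀)) (hfin i)
  filter_upwards [hRP, hsel', hfin'] with z hz hs hf
  rw [hz] at hs
  set p := P z.2 z.1 with hp
  have hstep : ∀ k, u (k + 1) z.2 z.1 = G k (p, u k z.2 z.1) := fun k => by rw [hu, hz]
  have hfink : ∀ k i, lam i p (u k z.2 z.1) ≠ ∞ := by
    intro k
    induction k with
    | zero => exact fun i => (hf i).ne
    | succ k ih =>
      intro i
      rw [hstep]
      exact ne_top_of_le_ne_top (ENNReal.add_ne_top.2 ⟨ENNReal.natCast_ne_top _, ih i⟩) (hrate _ _ _ _)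
  refine ⟨monotone_nat_of_le_succ fun k => ?_, le_antisymm ?_ ?_⟩
  · rw [hstep]
    exact hprofit _ _ _
  · refine iSup₂_le fun v hv => ?_
    change (profitRate lam p v : EReal) ≤ _
    -- Below any competing profit level there is a candidate `j` beating it, and the strategy after
    -- step `j` does at least as well as that candidate.
    refine le_of_forall_lt fun c hc => ?_
    obtain ⟨r, hcr, hr⟩ := EReal.exists_between_coe_real hc
    obtain ⟨j, hj, hjr⟩ := hs v hv r (EReal.coe_lt_coe_iff.1 hr)
    refine hcr.trans (lt_of_lt_of_le (EReal.coe_lt_coe_iff.2 (hjr.trans_le (hprofit' j p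
      (u j z.2 z.1) hj))) ?_)
    rw [← hstep]
    exact le_iSup (fun k => (profitRate lam p (u k z.2 z.1) : EReal)) (j + 1)
  · exact iSup_le fun k => profitRate_le_staticValue (hfink k)

end Control

/-! ### Reduction of the control problem to the expected profit rate -/

theorem isFiniteMeasure_timeMeasure_Ioc (t T : ℝ≥0) :
    IsFiniteMeasure (timeMeasure.restrict (Ioc t T)) := by
  refine ⟨?_⟩
  have hemb : MeasurableEmbedding ((↑) : ℝ≥0 → ℝ) :=
    MeasurableEmbedding.subtype_coe (measurableSet_Ici (a := (0 : ℝ)))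
  rw [Measure.restrict_apply_univ, timeMeasure, hemb.comap_apply]
  refine lt_of_le_of_lt (measure_mono (t := Icc (t : ℝ) T) ?_) measure_Icc_lt_top
  rintro _ ⟨s, hs, rfl⟩
  exact ⟨hs.1.le, hs.2⟩

section Value

variable {Ω : Type*} {mΩ : MeasurableSpace Ω} {μ : Measure Ω}
  {ℱ : Filtration ℝ≥0 mΩ} {n : ℕ} {t T : ℝ≥0} {A : Fin n → Set Ω} {P : CubeProcess Ω n}
  {lam : Fin n → Cube n → Cube n → ℝ≥0∞} {X : Ω → ℝ} {Q : Ω → Fin n → ℝ}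

theorem IsConditionalProbability.measurable_at (hP : IsConditionalProbability μ ℱ T A P) (s : ℝ≥0) :
    Measurable[ℱ s] (P s) :=
  (hP.progressive.stronglyAdapted s).measurable

theorem measurable_stateAt_filtration (hP : IsConditionalProbability μ ℱ T A P)
    (hX : Measurable[ℱ t] X) (hQ : Measurable[ℱ t] Q) : Measurable[ℱ t] (stateAt P t X Q) :=
  hX.prodMk ((hP.measurable_at t).prodMk hQ)

variable [IsProbabilityMeasure μ]

/-- By the tower property, a factor known at time `s` can be pulled out of the conditional
expectation. This prices the old book. -/
theorem IsConditionalProbability.integral_mul_indicator (hP : IsConditionalProbability μ ℱ T A P)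
    {s : ℝ≥0} (hs : s ≤ T) {i : Fin n} {f : Ω → ℝ} (hf : StronglyMeasurable[ℱ s] f)
    (hfi : Integrable f μ) :
    ∫ ω, f ω * (A i).indicator (fun _ => (1 : ℝ)) ω ∂μ = ∫ ω, f ω * P s ω i ∂μ := by
  have hA : MeasurableSet (A i) := ℱ.le T _ (hP.outcome_measurable i)
  have hAi : Integrable ((A i).indicator fun _ => (1 : ℝ)) μ := (integrable_const _).indicator hA
  have hprod : Integrable (f * (A i).indicator fun _ => (1 : ℝ)) μ := by
    have : f * ((A i).indicator fun _ => (1 : ℝ)) = (A i).indicator f := by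
      funext ω
      by_cases h : ω ∈ A i <;> simp [h]
    rw [this]
    exact hfi.indicator hA
  calc ∫ ω, f ω * (A i).indicator (fun _ => (1 : ℝ)) ω ∂μ
      = ∫ ω, (μ[f * (A i).indicator fun _ => (1 : ℝ) | ℱ s]) ω ∂μ := (integral_condExp (ℱ.le s)).symm
    _ = ∫ ω, f ω * P s ω i ∂μ := by
        refine integral_congr_ae ?_
        filter_upwards [condExp_mul_of_stronglyMeasurable_left hf hprod hAi, hP.version s hs i]
          with ω h1 h2
        rw [h1, h2]
        rfl

/-- The mean of the terminal wealth given the state, for a strategy whose random cash flow has the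
same expectations on events known at time `t` as `ρ`. -/
theorem objective_ae_eq (htT : t ≤ T) (hP : IsConditionalProbability μ ℱ T A P)
    (hX : Measurable[ℱ t] X) (hQ : Measurable[ℱ t] Q) {Y R ρ : Ω → ℝ} (hR : Integrable R μ)
    (hρ : Integrable ρ μ)
    (hY : Y =ᵐ[μ] fun ω => X ω - ∑ i, Q ω i * (A i).indicator (fun _ => (1 : ℝ)) ω + R ω)
    (hset : ∀ B, MeasurableSet[ℱ t] B → ∫ ω in B, R ω ∂μ = ∫ ω in B, ρ ω ∂μ) :
    ∀ᵐ z ∂μ.map (stateAt P t X Q), objective μ (fun y => y) (stateAt P t X Q) Y z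
      = (z.1 - ∑ i, (z.2.1 i : ℝ) * z.2.2 i) + ∫ y, y ∂condDistrib ρ (stateAt P t X Q) μ z := by
  have hSt := measurable_stateAt_filtration hP hX hQ
  have hS : Measurable (stateAt P t X Q) := hSt.mono (ℱ.le t) le_rfl
  have hXm : Measurable X := hX.mono (ℱ.le t) le_rfl
  have hQt : ∀ i, Measurable[ℱ t] fun ω => Q ω i := fun i => (measurable_pi_apply i).comp hQ
  have hQm : ∀ i, Measurable fun ω => Q ω i := fun i => (hQt i).mono (ℱ.le t) le_rfl
  have hPm : ∀ i, Measurable fun ω => (P t ω i : ℝ) := fun i => measurable_subtype_coe.comp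
    ((measurable_pi_apply i).comp ((hP.measurable_at t).mono (ℱ.le t) le_rfl))
  have hA : ∀ i, MeasurableSet (A i) := fun i => ℱ.le T _ (hP.outcome_measurable i)
  have hAm : ∀ i, Measurable ((A i).indicator fun _ => (1 : ℝ)) := fun i =>
    measurable_const.indicator (hA i)
  -- Neither `X` nor `Q` is assumed integrable; on these events of `σ(S)` both are bounded.
  let D : ℕ → Set (MarketState n) := fun m => {z | |z.1| ≤ m ∧ ∀ i, |z.2.2 i| ≤ m}
  have hD : ∀ m, MeasurableSet (D m) := fun m => by
    have : D m = {z | |z.1| ≤ (m : ℝ)} ∩ ⋂ i, {z | |z.2.2 i| ≤ (m : ℝ)} := by ext z; simp [D]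
    rw [this]
    refine (measurableSet_le (by fun_prop) measurable_const).inter
      (MeasurableSet.iInter fun i => measurableSet_le ?_ measurable_const)
    exact ((measurable_pi_apply i).comp (measurable_snd.comp measurable_snd)).abs
  have hDu : ∀ z, ∃ m, z ∈ D m := by
    intro z
    obtain ⟨m, hm⟩ := exists_nat_ge (|z.1| + ∑ i, |z.2.2 i|)
    refine ⟨m, (le_add_of_nonneg_right (Finset.sum_nonneg fun _ _ => abs_nonneg _)).trans hm, fun i => ?_⟩
    exact (Finset.single_le_sum (f := fun i => |z.2.2 i|) (fun _ _ => abs_nonneg _)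
      (Finset.mem_univ i)).trans ((le_add_of_nonneg_left (abs_nonneg _)).trans hm)
  have hXi : ∀ m, ∀ B ⊆ D m, MeasurableSet B → IntegrableOn X (stateAt P t X Q ⁻¹' B) μ := by
    intro m B hB hBm
    refine IntegrableOn.of_bound (C := m) (measure_lt_top _ _) hXm.aestronglyMeasurable ?_
    exact (ae_restrict_iff' (hS hBm)).2 (Eventually.of_forall fun ω hω => (hB hω).1)
  have hQi : ∀ m, ∀ B ⊆ D m, MeasurableSet B → ∀ i, ∀ h : Ω → ℝ, Measurable h → (∀ ω, |h ω| ≤ 1) →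
      IntegrableOn (fun ω => Q ω i * h ω) (stateAt P t X Q ⁻¹' B) μ := by
    intro m B hB hBm i h hh hh1
    refine IntegrableOn.of_bound (C := m) (measure_lt_top _ _)
      ((hQm i).mul hh).aestronglyMeasurable ?_
    refine (ae_restrict_iff' (hS hBm)).2 (Eventually.of_forall fun ω hω => ?_)
    rw [Real.norm_eq_abs, abs_mul]
    exact (mul_le_of_le_one_right (abs_nonneg _) (hh1 ω)).trans ((hB hω).2 i)
  have hA1 : ∀ i ω, |(A i).indicator (fun _ => (1 : ℝ)) ω| ≤ 1 := fun i ω => by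
    by_cases h : ω ∈ A i <;> simp [h]
  have hP1 : ∀ i ω, |(P t ω i : ℝ)| ≤ 1 := fun i ω => by
    rw [abs_of_nonneg (P t ω i).2.1]; exact (P t ω i).2.2
  have hYm : AEMeasurable Y μ := by
    refine AEMeasurable.congr ?_ hY.symm
    exact ((hXm.sub (Finset.measurable_sum _ fun i _ => (hQm i).mul (hAm i))).aemeasurable).add
      hR.aemeasurable
  refine integral_condDistrib_eq_add hS hYm hρ
    (c := fun z : MarketState n => z.1 - ∑ i, (z.2.1 i : ℝ) * z.2.2 i) ?_ hD hDu ?_ ?_ ?_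
  · refine measurable_fst.sub (Finset.measurable_sum _ fun i _ => Measurable.mul ?_ ?_)
    · exact measurable_subtype_coe.comp ((measurable_pi_apply i).comp
        (measurable_fst.comp measurable_snd))
    · exact (measurable_pi_apply i).comp (measurable_snd.comp measurable_snd)
  · intro m
    refine IntegrableOn.congr_fun_ae ?_ (ae_restrict_of_ae hY.symm)
    exact ((hXi m _ subset_rfl (hD m)).sub (integrable_finsetSum _ fun i _ =>
      hQi m _ subset_rfl (hD m) i _ (hAm i) (hA1 i))).add hR.integrableOn
  · intro m
    refine (hXi m _ subset_rfl (hD m)).sub (integrable_finsetSum _ fun i _ => ?_)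
    refine (hQi m _ subset_rfl (hD m) i _ (hPm i) (hP1 i)).congr (Eventually.of_forall fun ω => ?_)
    exact mul_comm _ _
  · intro m B hB hBm
    have hBt : MeasurableSet[ℱ t] (stateAt P t X Q ⁻¹' B) := hSt hBm
    have hQA : ∀ i, ∫ ω in stateAt P t X Q ⁻¹' B, Q ω i * (A i).indicator (fun _ => (1 : ℝ)) ω ∂μ
        = ∫ ω in stateAt P t X Q ⁻¹' B, (P t ω i : ℝ) * Q ω i ∂μ := by
      intro i
      rw [← integral_indicator (hS hBm), ← integral_indicator (hS hBm)]
      have h1 := hP.integral_mul_indicator htT (i := i)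
        (f := (stateAt P t X Q ⁻¹' B).indicator fun ω => Q ω i)
        ((hQt i).indicator hBt).stronglyMeasurable ?_
      · simp only [← indicator_mul_left] at h1
        rw [h1]
        refine integral_congr_ae (Eventually.of_forall fun ω => ?_)
        by_cases h : ω ∈ stateAt P t X Q ⁻¹' B
        · simp only [indicator_of_mem h, mul_comm]
        · simp only [indicator_of_notMem h, zero_mul]
      · rw [integrable_indicator_iff (hS hBm)]
        simpa using hQi m B hB hBm i (fun _ => 1) measurable_const (by simp)
    have hQP : ∀ i, IntegrableOn (fun ω => (P t ω i : ℝ) * Q ω i) (stateAt P t X Q ⁻¹' B) μ := fun i =>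
      (hQi m B hB hBm i _ (hPm i) (hP1 i)).congr (Eventually.of_forall fun ω => mul_comm _ _)
    rw [integral_congr_ae (ae_restrict_of_ae hY), integral_add, integral_sub, integral_finsetSum,
      hset _ hBt, Finset.sum_congr rfl fun i _ => hQA i]
    · change _ = ∫ ω in stateAt P t X Q ⁻¹' B, (X ω - ∑ i, (P t ω i : ℝ) * Q ω i + ρ ω) ∂μ
      rw [integral_add, integral_sub, integral_finsetSum]
      · exact fun i _ => hQP i
      · exact hXi m B hB hBm
      · exact integrable_finsetSum _ fun i _ => hQP i
      · exact (hXi m B hB hBm).sub (integrable_finsetSum _ fun i _ => hQP i)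
      · exact hρ.integrableOn
    · exact fun i _ => hQi m B hB hBm i _ (hAm i) (hA1 i)
    · exact hXi m B hB hBm
    · exact integrable_finsetSum _ fun i _ => hQi m B hB hBm i _ (hAm i) (hA1 i)
    · exact (hXi m B hB hBm).sub (integrable_finsetSum _ fun i _ =>
        hQi m B hB hBm i _ (hAm i) (hA1 i))
    · exact hR.integrableOn

/-- Minimality determines an essential supremum up to null sets, so it suffices that the static
formula is one. -/
theorem IsValueFunction.iff_ae_eq {ν : Measure (MarketState n)} {𝒜 : Set (CubeProcess Ω n)}
    {J : CubeProcess Ω n → MarketState n → ℝ} {F : MarketState n → EReal}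
    (hF : IsValueFunction ν 𝒜 J F) (V : MarketState n → EReal) :
    IsValueFunction ν 𝒜 J V ↔ V =ᵐ[ν] F := by
  constructor
  · intro hV
    filter_upwards [hV.2.2 F hF.1 hF.2.1, hF.2.2 V hV.1 hV.2.1] with z h1 h2
    exact le_antisymm h1 h2
  · intro h
    refine ⟨hF.1.congr h.symm, fun u hu => ?_, fun W hW hJW => ?_⟩
    · filter_upwards [hF.2.1 u hu, h] with z h1 h2
      rw [h2]; exact h1
    · filter_upwards [hF.2.2 W hW hJW, h] with z h1 h2
      rw [h2]; exact h1

/-- The static formula is the value function of the control problem, for any class of strategies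
which is stable under Borel functions of the strategy and of a version of `P`, and any arrivals of
bets for which the bookmaker earns the expected profit rate. -/
theorem isValueFunction_staticFormula (htT : t ≤ T) (hP : IsConditionalProbability μ ℱ T A P)
    (hlam : ∀ i, Measurable fun z : Cube n × Cube n => lam i z.1 z.2)
    (hX : Measurable[ℱ t] X) (hQ : Measurable[ℱ t] Q) {R : CubeProcess Ω n}
    (hR : AEMeasurable (fun z : Ω × ℝ≥0 => R z.2 z.1) (μ.prod (timeMeasure.restrict (Ioc t T))))
    (hRP : ∀ᵐ z ∂μ.prod (timeMeasure.restrict (Ioc t T)), R z.2 z.1 = P z.2 z.1)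
    {𝒞 : Set (CubeProcess Ω n)}
    (h𝒞 : ∀ u ∈ 𝒞, ∀ G : Cube n × Cube n → Cube n, Measurable G →
      (fun s ω => G (R s ω, u s ω)) ∈ 𝒞)
    (h𝒞m : ∀ u ∈ 𝒞, AEMeasurable (fun z : Ω × ℝ≥0 => u z.2 z.1)
      (μ.prod (timeMeasure.restrict (Ioc t T))))
    (dQ : CubeProcess Ω n → Fin n → Ω → Measure ℝ≥0)
    (hdQ : ∀ u ∈ 𝒞, FiniteExpectedBets μ lam P t T u → ∃ C : Ω → ℝ, Integrable C μ ∧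
      (terminalWealth A X Q (dQ u) u
        =ᵐ[μ] fun ω => X ω - ∑ i, Q ω i * (A i).indicator (fun _ => (1 : ℝ)) ω + C ω) ∧
      ∀ B, MeasurableSet[ℱ t] B → ∫ ω in B, C ω ∂μ
        = ∫ ω in B, ∫ s in Ioc t T, profitRate lam (P s ω) (u s ω) ∂timeMeasure ∂μ)
    (hne : {u | u ∈ 𝒞 ∧ FiniteExpectedBets μ lam P t T u}.Nonempty) :
    IsValueFunction (μ.map (stateAt P t X Q)) {u | u ∈ 𝒞 ∧ FiniteExpectedBets μ lam P t T u}
      (fun u => objective μ (fun y => y) (stateAt P t X Q) (terminalWealth A X Q (dQ u) u))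
      (staticFormula μ lam P t T (stateAt P t X Q)) := by
  have := isFiniteMeasure_timeMeasure_Ioc t T
  set θ := timeMeasure.restrict (Ioc t T) with hθ
  have hPm : AEMeasurable (fun z : Ω × ℝ≥0 => P z.2 z.1) (μ.prod θ) := hR.congr hRP
  have hS : Measurable (stateAt P t X Q) :=
    (measurable_stateAt_filtration hP hX hQ).mono (ℱ.le t) le_rfl
  have hfeb : ∀ u ∈ 𝒞, (FiniteExpectedBets μ lam P t T u ↔
      ∀ i, ∫⁻ z, lam i (P z.2 z.1) (u z.2 z.1) ∂μ.prod θ ≠ ∞) := by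
    intro u hu
    refine forall_congr' fun i => ?_
    rw [lintegral_prod (fun z : Ω × ℝ≥0 => lam i (P z.2 z.1) (u z.2 z.1))
      ((hlam i).comp_aemeasurable (hPm.prodMk (h𝒞m u hu)))]
  let ρ : CubeProcess Ω n → Ω → ℝ := fun u ω => ∫ s, profitRate lam (P s ω) (u s ω) ∂θ
  have hint : ∀ u ∈ 𝒞, FiniteExpectedBets μ lam P t T u →
      Integrable (fun z : Ω × ℝ≥0 => profitRate lam (P z.2 z.1) (u z.2 z.1)) (μ.prod θ) :=
    fun u hu hf => integrable_profitRate hlam hPm (h𝒞m u hu) ((hfeb u hu).1 hf)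
  have hρ : ∀ u ∈ 𝒞, FiniteExpectedBets μ lam P t T u → Integrable (ρ u) μ :=
    fun u hu hf => (hint u hu hf).integral_prod_left
  have hobj : ∀ u ∈ 𝒞, FiniteExpectedBets μ lam P t T u →
      ∀ᵐ z ∂μ.map (stateAt P t X Q),
        objective μ (fun y => y) (stateAt P t X Q) (terminalWealth A X Q (dQ u) u) z
          = (z.1 - ∑ i, (z.2.1 i : ℝ) * z.2.2 i)
            + ∫ y, y ∂condDistrib (ρ u) (stateAt P t X Q) μ z := by
    intro u hu hf
    obtain ⟨C, hC, hCY, hCB⟩ := hdQ u hu hf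
    exact objective_ae_eq htT hP hX hQ hC (hρ u hu hf) hCY hCB
  obtain ⟨u₀, hu₀, hf₀⟩ := hne
  obtain ⟨w, hw, hwlim⟩ := exists_strategies_tendsto_staticValue hlam hR hRP h𝒞 hu₀
    ((hfeb u₀ hu₀).1 hf₀) (h𝒞m u₀ hu₀)
  have hwf : ∀ k, FiniteExpectedBets μ lam P t T (w k) := fun k => (hfeb _ (hw k).1).2 (hw k).2
  let Φ : Ω → EReal := fun ω => extIntegral θ (fun s => staticValue lam (P s ω))
  have hwint : ∀ᵐ ω ∂μ, ∀ k, Integrable (fun s => profitRate lam (P s ω) (w k s ω)) θ :=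
    ae_all_iff.2 fun k => (hint _ (hw k).1 (hwf k)).prod_right_ae
  have hwlim' := Measure.ae_ae_of_ae_prod hwlim
  have hmono : ∀ᵐ ω ∂μ, Monotone fun k => ρ (w k) ω := by
    filter_upwards [hwint, hwlim'] with ω h1 h2 k l hkl
    exact integral_mono_ae (h1 k) (h1 l) (h2.mono fun s hs => hs.1 hkl)
  have hΦ : ∀ᵐ ω ∂μ, Φ ω = ⨆ k, (ρ (w k) ω : EReal) := by
    filter_upwards [hwint, hwlim'] with ω h1 h2
    exact extIntegral_iSup h1 (h2.mono fun s hs => hs.1) (h2.mono fun s hs => hs.2)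
  -- `staticValue` is a supremum over uncountably many prices; measurability comes from the
  -- countable supremum along `w`.
  have hΦm : AEMeasurable Φ μ :=
    (AEMeasurable.iSup fun k => (hρ _ (hw k).1 (hwf k)).aemeasurable.coe_real_ereal).congr
      (hΦ.mono fun ω h => h.symm)
  have hformula : ∀ᵐ z ∂μ.map (stateAt P t X Q), staticFormula μ lam P t T (stateAt P t X Q) z
      = ⨆ k, (((z.1 - ∑ i, (z.2.1 i : ℝ) * z.2.2 i)
          + ∫ y, y ∂condDistrib (ρ (w k)) (stateAt P t X Q) μ z : ℝ) : EReal) := by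
    filter_upwards [extIntegral_condDistrib_iSup hS (fun k => hρ _ (hw k).1 (hwf k)) hmono hΦ] with z hz
    change (((z.1 - ∑ i, (z.2.1 i : ℝ) * z.2.2 i : ℝ)) : EReal)
      + extIntegral (condDistrib Φ (stateAt P t X Q) μ z) (fun y => y) = _
    rw [hz]
    simp_rw [EReal.coe_add]
    -- Adding a real constant commutes with suprema in `EReal`, since subtracting it is the inverse
    -- order isomorphism.
    refine le_antisymm ?_ (iSup_le fun k => add_le_add le_rfl (le_iSup
      (fun k => ((∫ y, y ∂condDistrib (ρ (w k)) (stateAt P t X Q) μ z : ℝ) : EReal)) k))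
    rw [add_comm]
    refine (EReal.le_sub_iff_add_le (Or.inl (EReal.coe_ne_bot _)) (Or.inl (EReal.coe_ne_top _))).1 ?_
    refine iSup_le fun k => ?_
    refine (EReal.le_sub_iff_add_le (Or.inl (EReal.coe_ne_bot _)) (Or.inl (EReal.coe_ne_top _))).2 ?_
    rw [add_comm]
    exact le_iSup (fun k => ((z.1 - ∑ i, (z.2.1 i : ℝ) * z.2.2 i : ℝ) : EReal)
      + ((∫ y, y ∂condDistrib (ρ (w k)) (stateAt P t X Q) μ z : ℝ) : EReal)) k
  refine ⟨?_, ?_, ?_⟩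
  · refine AEMeasurable.congr (AEMeasurable.iSup fun k => ?_) (hformula.mono fun z h => h.symm)
    refine AEMeasurable.coe_real_ereal ?_
    have h1 : Measurable fun z : MarketState n =>
        objective μ (fun y => y) (stateAt P t X Q) (terminalWealth A X Q (dQ (w k)) (w k)) z :=
      (StronglyMeasurable.integral_condDistrib (f := fun x : MarketState n × ℝ => x.2)
        measurable_snd.stronglyMeasurable).measurable
    exact h1.aemeasurable.congr (hobj _ (hw k).1 (hwf k))
  · rintro u ⟨hu, hf⟩
    -- Finite expected bets force finite rates almost everywhere, so `u` competes in the static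
    -- supremum.
    have hle : ∀ᵐ ω ∂μ, (ρ u ω : EReal) ≤ Φ ω := by
      have hfin : ∀ᵐ z ∂μ.prod θ, ∀ i, lam i (P z.2 z.1) (u z.2 z.1) < ∞ := ae_all_iff.2 fun i =>
        ae_lt_top' ((hlam i).comp_aemeasurable (hPm.prodMk (h𝒞m u hu))) ((hfeb u hu).1 hf i)
      filter_upwards [Measure.ae_ae_of_ae_prod hfin, (hint u hu hf).prod_right_ae] with ω h1 h2
      exact coe_integral_le_extIntegral h2
        (h1.mono fun s hs => profitRate_le_staticValue fun i => (hs i).ne)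
    filter_upwards [hobj u hu hf, coe_integral_condDistrib_le hS (hρ u hu hf) hΦm hle] with z h1 h2
    rw [h1, EReal.coe_add]
    exact add_le_add le_rfl h2
  -- The formula is the supremum of the countably many objectives of `w k`, and a majorant dominates
  -- all of them off one null set.
  · intro W hW hJW
    have := fun k => hJW (w k) ⟨(hw k).1, hwf k⟩
    filter_upwards [hformula, ae_all_iff.2 this, ae_all_iff.2 fun k => hobj _ (hw k).1 (hwf k)]
      with z h1 h2 h3
    rw [h1]
    exact iSup_le fun k => h3 k ▸ h2 k

end Value

/-! ### Conditioning on outcomes and the expected cash flow of a strategy -/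

section Arrivals

variable {Ω : Type*} {mΩ : MeasurableSpace Ω} {μ : Measure Ω}
  {ℱ : Filtration ℝ≥0 mΩ} {n : ℕ} {t T : ℝ≥0} {A : Fin n → Set Ω} {P u : CubeProcess Ω n}
  {lam : Fin n → Cube n → Cube n → ℝ≥0∞} {X : Ω → ℝ} {Q : Ω → Fin n → ℝ}

/-- Progressive measurability controls `u` only on `[0, T] × Ω`; stopping time at `T` gives a
jointly measurable map that is unchanged on `(t, T]`. -/
theorem measurable_min_of_isStronglyProgressive (hu : IsStronglyProgressive ℱ u) (T : ℝ≥0) :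
    Measurable fun z : Ω × ℝ≥0 => u (min z.2 T) z.1 := by
  have h1 : Measurable fun z : Iic T × Ω => u z.1 z.2 :=
    (hu T).measurable.mono (sup_le_sup le_rfl (MeasurableSpace.comap_mono (ℱ.le T))) le_rfl
  have h2 : Measurable fun z : Ω × ℝ≥0 => ((⟨min z.2 T, mem_Iic.2 (min_le_right _ _)⟩, z.1) : Iic T × Ω) :=
    (Measurable.subtype_mk (measurable_snd.min measurable_const)).prodMk measurable_fst
  exact h1.comp h2

theorem ae_prod_mem_Ioc [SFinite μ] (t T : ℝ≥0) :
    ∀ᵐ z ∂μ.prod (timeMeasure.restrict (Ioc t T)), z.2 ∈ Ioc t T := by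
  have := isFiniteMeasure_timeMeasure_Ioc t T
  exact Measure.quasiMeasurePreserving_snd.ae (ae_restrict_mem measurableSet_Ioc)

theorem aemeasurable_of_isStronglyProgressive [SFinite μ] (hu : IsStronglyProgressive ℱ u) :
    AEMeasurable (fun z : Ω × ℝ≥0 => u z.2 z.1) (μ.prod (timeMeasure.restrict (Ioc t T))) := by
  refine (measurable_min_of_isStronglyProgressive hu T).aemeasurable.congr ?_
  filter_upwards [ae_prod_mem_Ioc t T] with z hz
  rw [min_eq_left hz.2]

theorem measurable_coord (i : Fin n) : Measurable fun p : Cube n => (p i : ℝ) :=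
  measurable_subtype_coe.comp (measurable_pi_apply i)

theorem measurable_ofReal_coord (i : Fin n) : Measurable fun p : Cube n => ENNReal.ofReal (p i) :=
  (measurable_coord i).ennreal_ofReal

variable [IsProbabilityMeasure μ]

/-- The restriction of `μ` to `A i` and the measure with density `P s · i` coincide on `ℱ s`.
Working with measures avoids any integrability of `f`. -/
theorem IsConditionalProbability.setLIntegral_eq (hP : IsConditionalProbability μ ℱ T A P)
    {s : ℝ≥0} (hs : s ≤ T) (i : Fin n) {f : Ω → ℝ≥0∞} (hf : Measurable[ℱ s] f) :
    ∫⁻ ω in A i, f ω ∂μ = ∫⁻ ω, ENNReal.ofReal (P s ω i) * f ω ∂μ := by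
  have hle := ℱ.le s
  have hA : MeasurableSet (A i) := ℱ.le T _ (hP.outcome_measurable i)
  have hPm : Measurable fun ω => ENNReal.ofReal (P s ω i) :=
    (measurable_ofReal_coord i).comp ((hP.measurable_at s).mono hle le_rfl)
  have hAi : Integrable ((A i).indicator fun _ => (1 : ℝ)) μ := (integrable_const _).indicator hA
  have key : (μ.restrict (A i)).trim hle
      = (μ.withDensity fun ω => ENNReal.ofReal (P s ω i)).trim hle := by
    refine @Measure.ext _ (ℱ s) _ _ fun E hE => ?_
    rw [trim_measurableSet_eq hle hE, trim_measurableSet_eq hle hE, withDensity_apply _ (hle _ hE),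
      Measure.restrict_apply (hle _ hE)]
    have h1 : ∫ ω in E, (P s ω i : ℝ) ∂μ = μ.real (A i ∩ E) := by
      rw [setIntegral_congr_ae (hle _ hE) ((hP.version s hs i).mono fun ω h _ => h),
        setIntegral_condExp hle hAi hE, setIntegral_indicator hA]
      simp [inter_comm]
    have hPi : Integrable (fun ω => (P s ω i : ℝ)) (μ.restrict E) :=
      (Integrable.congr integrable_condExp (hP.version s hs i).symm).integrableOn
    rw [← ofReal_integral_eq_lintegral_ofReal hPi (Eventually.of_forall fun ω => (P s ω i).2.1), h1,
      ofReal_measureReal, inter_comm]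
  rw [← lintegral_trim hle hf, key, lintegral_trim hle hf,
    lintegral_withDensity_eq_lintegral_mul _ hPm (hf.mono hle le_rfl)]
  rfl

theorem IsConditionalProbability.setLIntegral_inter_eq (hP : IsConditionalProbability μ ℱ T A P)
    {s : ℝ≥0} (hs : s ≤ T) (i : Fin n) {f : Ω → ℝ≥0∞} (hf : Measurable[ℱ s] f) {B : Set Ω}
    (hB : MeasurableSet[ℱ s] B) :
    ∫⁻ ω in A i ∩ B, f ω ∂μ = ∫⁻ ω in B, ENNReal.ofReal (P s ω i) * f ω ∂μ := by
  have hBm : MeasurableSet B := ℱ.le s _ hB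
  have h1 := hP.setLIntegral_eq hs i (hf.indicator hB)
  rw [setLIntegral_indicator hBm] at h1
  rw [inter_comm, h1, ← lintegral_indicator hBm]
  refine lintegral_congr fun ω => ?_
  by_cases h : ω ∈ B <;> simp [h]

/-- Passes between Bochner integrals and the extended nonnegative ones in which arrivals are
computed; a weight at most one preserves the finiteness of the integral of the rate. -/
theorem setIntegral_integral_toReal_rate_mul {θ : Measure ℝ≥0} [IsFiniteMeasure θ]
    {g w : Ω × ℝ≥0 → ℝ≥0∞} (hg : AEMeasurable g (μ.prod θ)) (hfin : ∫⁻ z, g z ∂μ.prod θ ≠ ∞)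
    (hw : AEMeasurable w (μ.prod θ)) (hw1 : ∀ z, w z ≤ 1) (B : Set Ω) :
    Integrable (fun z => (g z).toReal * (w z).toReal) (μ.prod θ) ∧
    ∫ ω in B, ∫ s, (g (ω, s)).toReal * (w (ω, s)).toReal ∂θ ∂μ
      = (∫⁻ ω in B, ∫⁻ s, w (ω, s) * g (ω, s) ∂θ ∂μ).toReal := by
  have hle : μ.restrict B ≪ μ := Measure.restrict_le_self.absolutelyContinuous
  have hac : (μ.restrict B).prod θ ≪ μ.prod θ := hle.prod .rfl
  have hwg : AEMeasurable (fun z => w z * g z) (μ.prod θ) := hw.mul hg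
  have hwgle : ∫⁻ z, w z * g z ∂μ.prod θ ≤ ∫⁻ z, g z ∂μ.prod θ :=
    lintegral_mono fun z => mul_le_of_le_one_left' (hw1 z)
  have heq : (fun z => (g z).toReal * (w z).toReal) = fun z => (w z * g z).toReal := by
    funext z
    rw [ENNReal.toReal_mul, mul_comm]
  have hint : Integrable (fun z => (w z * g z).toReal) (μ.prod θ) :=
    integrable_toReal_of_lintegral_ne_top hwg (ne_top_of_le_ne_top hfin hwgle)
  refine ⟨heq ▸ hint, ?_⟩
  have hint' : Integrable (fun z => (w z * g z).toReal) ((μ.restrict B).prod θ) :=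
    hint.mono_measure (Measure.prod_mono Measure.restrict_le_self le_rfl)
  have h1 : ∫ ω in B, ∫ s, (g (ω, s)).toReal * (w (ω, s)).toReal ∂θ ∂μ
      = ∫ z, (w z * g z).toReal ∂(μ.restrict B).prod θ := by
    rw [integral_prod _ hint']
    simp only [ENNReal.toReal_mul, mul_comm]
  rw [h1, integral_toReal (hwg.mono_ac hac), lintegral_prod _ (hwg.mono_ac hac)]
  exact ae_lt_top' (hwg.mono_ac hac) (ne_top_of_le_ne_top hfin ((lintegral_mono'
    (Measure.prod_mono Measure.restrict_le_self le_rfl) le_rfl).trans hwgle))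

/-- The cash flow of a strategy, from the expectations of the revenue and of the liabilities on
events known at time `t`. -/
theorem exists_cashFlow (hlam : ∀ i, Measurable fun z : Cube n × Cube n => lam i z.1 z.2)
    (hPm : AEMeasurable (fun z : Ω × ℝ≥0 => P z.2 z.1) (μ.prod (timeMeasure.restrict (Ioc t T))))
    (hum : AEMeasurable (fun z : Ω × ℝ≥0 => u z.2 z.1) (μ.prod (timeMeasure.restrict (Ioc t T))))
    (hfeb : FiniteExpectedBets μ lam P t T u) (hA : ∀ i, MeasurableSet (A i))
    {dQ : Fin n → Ω → Measure ℝ≥0}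
    (hmass : ∀ i, AEMeasurable (fun ω => dQ i ω univ) μ)
    (hmass_fin : ∀ i, ∫⁻ ω, dQ i ω univ ∂μ ≠ ∞)
    (hrev_meas : ∀ i, AEMeasurable (fun ω => ∫⁻ s, ENNReal.ofReal (u s ω i) ∂dQ i ω) μ)
    (hu : ∀ i, ∀ᵐ ω ∂μ, AEStronglyMeasurable (fun s => (u s ω i : ℝ)) (dQ i ω))
    (hrev : ∀ i B, MeasurableSet[ℱ t] B →
      ∫⁻ ω in B, ∫⁻ s, ENNReal.ofReal (u s ω i) ∂dQ i ω ∂μ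
        = ∫⁻ ω in B, ∫⁻ s in Ioc t T, ENNReal.ofReal (u s ω i) * lam i (P s ω) (u s ω) ∂timeMeasure ∂μ)
    (hclaim : ∀ i B, MeasurableSet[ℱ t] B →
      ∫⁻ ω in A i ∩ B, dQ i ω univ ∂μ
        = ∫⁻ ω in B, ∫⁻ s in Ioc t T, ENNReal.ofReal (P s ω i) * lam i (P s ω) (u s ω)
            ∂timeMeasure ∂μ) :
    ∃ C : Ω → ℝ, Integrable C μ ∧
      (terminalWealth A X Q dQ u
        =ᵐ[μ] fun ω => X ω - ∑ i, Q ω i * (A i).indicator (fun _ => (1 : ℝ)) ω + C ω) ∧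
      ∀ B, MeasurableSet[ℱ t] B → ∫ ω in B, C ω ∂μ
        = ∫ ω in B, ∫ s in Ioc t T, profitRate lam (P s ω) (u s ω) ∂timeMeasure ∂μ := by
  have := isFiniteMeasure_timeMeasure_Ioc t T
  set θ := timeMeasure.restrict (Ioc t T) with hθ
  let r : Fin n → Ω → ℝ≥0∞ := fun i ω => ∫⁻ s, ENNReal.ofReal (u s ω i) ∂dQ i ω
  let m : Fin n → Ω → ℝ≥0∞ := fun i ω => (A i).indicator (fun ω => dQ i ω univ) ω
  have hmm : ∀ i, AEMeasurable (m i) μ := fun i => (hmass i).indicator (hA i)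
  have hle1 : ∀ x : unitInterval, ENNReal.ofReal x ≤ 1 := fun x => ENNReal.ofReal_le_one.2 x.2.2
  have hrle : ∀ i ω, r i ω ≤ dQ i ω univ := fun i ω => by
    calc r i ω ≤ ∫⁻ _, 1 ∂dQ i ω := lintegral_mono fun s => hle1 _
      _ = dQ i ω univ := by simp
  have hmle : ∀ i ω, m i ω ≤ dQ i ω univ := fun i ω => indicator_le_self _ _ _
  have hrfin : ∀ i, ∫⁻ ω, r i ω ∂μ ≠ ∞ := fun i =>
    ne_top_of_le_ne_top (hmass_fin i) (lintegral_mono (hrle i))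
  have hmfin : ∀ i, ∫⁻ ω, m i ω ∂μ ≠ ∞ := fun i =>
    ne_top_of_le_ne_top (hmass_fin i) (lintegral_mono (hmle i))
  have hri : ∀ i, Integrable (fun ω => (r i ω).toReal) μ := fun i =>
    integrable_toReal_of_lintegral_ne_top (hrev_meas i) (hrfin i)
  have hmi : ∀ i, Integrable (fun ω => (m i ω).toReal) μ := fun i =>
    integrable_toReal_of_lintegral_ne_top (hmm i) (hmfin i)
  -- The cash flow is the revenue `r` from the new bets minus their payout `m`.
  refine ⟨fun ω => ∑ i, ((r i ω).toReal - (m i ω).toReal),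
    integrable_finsetSum _ fun i _ => (hri i).sub (hmi i), ?_, ?_⟩
  · filter_upwards [ae_all_iff.2 hu] with ω hω
    have h1 : ∀ i, ∫ s, (u s ω i : ℝ) ∂dQ i ω = (r i ω).toReal := fun i =>
      integral_eq_lintegral_of_nonneg_ae (Eventually.of_forall fun s => (u s ω i).2.1) (hω i)
    have h2 : ∀ i, (A i).indicator (fun _ => (1 : ℝ)) ω * (Q ω i + (dQ i ω).real univ)
        = Q ω i * (A i).indicator (fun _ => (1 : ℝ)) ω + (m i ω).toReal := fun i => by
      by_cases h : ω ∈ A i <;> simp [m, h, Measure.real]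
    simp only [terminalWealth, h1, h2, Finset.sum_add_distrib, Finset.sum_sub_distrib]
    ring
  · intro B hB
    have hBm : MeasurableSet B := ℱ.le t _ hB
    have hg : ∀ i, AEMeasurable (fun z : Ω × ℝ≥0 => lam i (P z.2 z.1) (u z.2 z.1)) (μ.prod θ) :=
      fun i => (hlam i).comp_aemeasurable (hPm.prodMk hum)
    have hgf : ∀ i, ∫⁻ z : Ω × ℝ≥0, lam i (P z.2 z.1) (u z.2 z.1) ∂μ.prod θ ≠ ∞ := fun i => by
      rw [lintegral_prod _ (hg i)]
      exact hfeb i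
    have hU := fun i => setIntegral_integral_toReal_rate_mul
      (w := fun z : Ω × ℝ≥0 => ENNReal.ofReal (u z.2 z.1 i)) (hg i) (hgf i)
      ((measurable_ofReal_coord i).comp_aemeasurable hum) (fun z => hle1 _) B
    have hV := fun i => setIntegral_integral_toReal_rate_mul
      (w := fun z : Ω × ℝ≥0 => ENNReal.ofReal (P z.2 z.1 i)) (hg i) (hgf i)
      ((measurable_ofReal_coord i).comp_aemeasurable hPm) (fun z => hle1 _) B
    have hsub : ∀ p v : Cube n, profitRate lam p v = ∑ i, ((lam i p v).toReal
        * (ENNReal.ofReal (v i)).toReal - (lam i p v).toReal * (ENNReal.ofReal (p i)).toReal) := by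
      intro p v
      refine Finset.sum_congr rfl fun i _ => ?_
      rw [ENNReal.toReal_ofReal (v i).2.1, ENNReal.toReal_ofReal (p i).2.1, mul_sub]
    have hρ : ∀ᵐ ω ∂μ, ∫ s, profitRate lam (P s ω) (u s ω) ∂θ
        = ∑ i, (∫ s, (lam i (P s ω) (u s ω)).toReal * (ENNReal.ofReal (u s ω i)).toReal ∂θ
          - ∫ s, (lam i (P s ω) (u s ω)).toReal * (ENNReal.ofReal (P s ω i)).toReal ∂θ) := by
      filter_upwards [ae_all_iff.2 fun i => (hU i).1.prod_right_ae,
        ae_all_iff.2 fun i => (hV i).1.prod_right_ae] with ω h1 h2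
      simp only [hsub]
      refine (integral_finsetSum _ fun i _ => (h1 i).sub (h2 i)).trans ?_
      exact Finset.sum_congr rfl fun i _ => integral_sub (h1 i) (h2 i)
    refine (integral_finsetSum _ fun i _ => ((hri i).sub (hmi i)).integrableOn).trans ?_
    refine Eq.trans ?_ (integral_congr_ae (ae_restrict_of_ae hρ)).symm
    refine Eq.trans ?_ (integral_finsetSum _ fun i _ =>
      ((hU i).1.integral_prod_left.sub (hV i).1.integral_prod_left).integrableOn).symm
    refine Finset.sum_congr rfl fun i _ => ?_
    refine (integral_sub (hri i).integrableOn (hmi i).integrableOn).trans (Eq.trans ?_ (integral_sub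
      (hU i).1.integral_prod_left.integrableOn (hV i).1.integral_prod_left.integrableOn).symm)
    congr 1
    · refine Eq.trans ?_ (hU i).2.symm
      rw [integral_toReal (hrev_meas i).restrict
        (ae_restrict_of_ae (ae_lt_top' (hrev_meas i) (hrfin i)))]
      exact congrArg ENNReal.toReal (hrev i B hB)
    · refine Eq.trans ?_ (hV i).2.symm
      rw [integral_toReal (hmm i).restrict (ae_restrict_of_ae (ae_lt_top' (hmm i) (hmfin i)))]
      refine congrArg ENNReal.toReal (Eq.trans ?_ (hclaim i B hB))
      rw [lintegral_indicator (hA i), Measure.restrict_restrict (hA i)]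

/-! ### Continuous arrivals -/

/-- The revenue identity is the definition of a density; only the liabilities need conditioning. -/
theorem exists_cashFlow_continuousArrivals (hP : IsConditionalProbability μ ℱ T A P)
    (hlam : ∀ i, Measurable fun z : Cube n × Cube n => lam i z.1 z.2)
    (hu : IsStronglyProgressive ℱ u) (hfeb : FiniteExpectedBets μ lam P t T u) :
    ∃ C : Ω → ℝ, Integrable C μ ∧
      (terminalWealth A X Q (continuousArrivals lam P t T u) u
        =ᵐ[μ] fun ω => X ω - ∑ i, Q ω i * (A i).indicator (fun _ => (1 : ℝ)) ω + C ω) ∧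
      ∀ B, MeasurableSet[ℱ t] B → ∫ ω in B, C ω ∂μ
        = ∫ ω in B, ∫ s in Ioc t T, profitRate lam (P s ω) (u s ω) ∂timeMeasure ∂μ := by
  have := isFiniteMeasure_timeMeasure_Ioc t T
  have hPm := aemeasurable_of_isStronglyProgressive (μ := μ) (t := t) (T := T) hP.progressive
  have hum := aemeasurable_of_isStronglyProgressive (μ := μ) (t := t) (T := T) hu
  have hA : ∀ i, MeasurableSet (A i) := fun i => ℱ.le T _ (hP.outcome_measurable i)
  set θ := timeMeasure.restrict (Ioc t T) with hθ
  have hg : ∀ i, AEMeasurable (fun z : Ω × ℝ≥0 => lam i (P z.2 z.1) (u z.2 z.1)) (μ.prod θ) :=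
    fun i => (hlam i).comp_aemeasurable (hPm.prodMk hum)
  have hgω : ∀ i, ∀ᵐ ω ∂μ, AEMeasurable (fun s => lam i (P s ω) (u s ω)) θ := fun i =>
    ((hg i).aestronglyMeasurable.prodMk_left).mono fun ω h => h.aemeasurable
  have huω : ∀ i, ∀ᵐ ω ∂μ, AEMeasurable (fun s => (u s ω i : ℝ)) θ := fun i => by
    have h1 : AEMeasurable (fun z : Ω × ℝ≥0 => (u z.2 z.1 i : ℝ)) (μ.prod θ) :=
      (measurable_coord i).comp_aemeasurable hum
    exact (h1.aestronglyMeasurable.prodMk_left).mono fun ω h => h.aemeasurable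
  have hmass_eq : ∀ i ω, continuousArrivals lam P t T u i ω univ
      = ∫⁻ s, lam i (P s ω) (u s ω) ∂θ := fun i ω => by
    rw [continuousArrivals, withDensity_apply _ MeasurableSet.univ, Measure.restrict_univ]
  have hrev_eq : ∀ i, ∀ᵐ ω ∂μ, ∫⁻ s, ENNReal.ofReal (u s ω i) ∂continuousArrivals lam P t T u i ω
      = ∫⁻ s, ENNReal.ofReal (u s ω i) * lam i (P s ω) (u s ω) ∂θ := fun i => by
    filter_upwards [hgω i, huω i] with ω h1 h2
    rw [continuousArrivals, lintegral_withDensity_eq_lintegral_mul₀' h1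
      (h2.ennreal_ofReal.mono_ac (withDensity_absolutelyContinuous _ _))]
    simp only [Pi.mul_apply, mul_comm]
  refine exists_cashFlow (ℱ := ℱ) hlam hPm hum hfeb hA ?_ ?_ ?_ ?_ ?_ ?_
  · intro i
    simp only [hmass_eq]
    exact (hg i).lintegral_prod_right'
  · intro i
    simp only [hmass_eq]
    exact hfeb i
  · intro i
    refine AEMeasurable.congr ?_ ((hrev_eq i).mono fun ω h => h.symm)
    exact (((measurable_ofReal_coord i).comp_aemeasurable hum).mul (hg i)).lintegral_prod_right'
  · intro i
    filter_upwards [huω i] with ω h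
    exact (h.mono_ac (withDensity_absolutelyContinuous _ _)).aestronglyMeasurable
  · intro i B _
    exact lintegral_congr_ae (ae_restrict_of_ae (hrev_eq i))
  · intro i B hB
    have hBm : MeasurableSet B := ℱ.le t _ hB
    have hac : ∀ E : Set Ω, (μ.restrict E).prod θ ≪ μ.prod θ := fun E =>
      (Measure.restrict_le_self.absolutelyContinuous).prod .rfl
    simp only [hmass_eq]
    -- With time outermost, the rate at time `s` is `ℱ s`-measurable, so `A i` can be replaced by `P
    -- s · i` for each `s` separately.
    rw [lintegral_lintegral_swap (f := fun ω s => lam i (P s ω) (u s ω)) ((hg i).mono_ac (hac _)),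
      lintegral_lintegral_swap (f := fun ω s => ENNReal.ofReal (P s ω i) * lam i (P s ω) (u s ω))
        ((((measurable_ofReal_coord i).comp_aemeasurable hPm).mul (hg i)).mono_ac (hac _))]
    refine setLIntegral_congr_fun measurableSet_Ioc fun s hs => ?_
    have hf : Measurable[ℱ s] fun ω => lam i (P s ω) (u s ω) :=
      (hlam i).comp ((hP.measurable_at s).prodMk (hu.stronglyAdapted s).measurable)
    exact hP.setLIntegral_inter_eq hs.2 i hf (ℱ.mono hs.1.le _ hB)

end Arrivals

/-! ### Paths of counting processes -/

section Paths

theorem strictMonoOn_jumpTimes (N : ℝ≥0 → ℕ) (t T : ℝ≥0) : StrictMonoOn N (jumpTimes N t T) :=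
  fun s hs _ hs' hlt => hs'.2 s ⟨hs.1.1.le, hlt⟩

/-- A path on `[t, T]` which is nondecreasing and right-continuous and has unit jumps. -/
structure IsCountingPath (N : ℝ≥0 → ℕ) (t T : ℝ≥0) : Prop where
  monotoneOn : MonotoneOn N (Icc t T)
  continuousWithinAt : ∀ s ∈ Ico t T, ContinuousWithinAt N (Ici s) s
  unit_jumps : ∀ s ∈ Ioc t T, ∃ r ∈ Ico t s, N s ≤ N r + 1

/-- A nondecreasing right-continuous path with unit jumps takes each intermediate value at a jump. -/
theorem exists_mem_jumpTimes_eq {N : ℝ≥0 → ℕ} {t T : ℝ≥0} (hN : IsCountingPath N t T) {r s : ℝ≥0} (hr : t ≤ r) (hs : s ≤ T)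
    {k : ℕ} (hrk : N r < k) (hks : k ≤ N s) (hrs : r ≤ s) :
    ∃ v ∈ jumpTimes N t T, v ∈ Ioc r s ∧ N v = k := by
  -- The jump sought is the first time `τ` at which the level `k` is reached.
  let H : Set ℝ≥0 := {v | v ∈ Icc r s ∧ k ≤ N v}
  have hsH : s ∈ H := ⟨⟨hrs, le_rfl⟩, hks⟩
  have hbdd : BddBelow H := OrderBot.bddBelow H
  set τ := sInf H with hτ
  have hτs : τ ≤ s := csInf_le hbdd hsH
  have hrτ : r ≤ τ := le_csInf ⟨s, hsH⟩ fun v hv => hv.1.1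
  have hlt : ∀ v ∈ Ico r τ, N v < k := by
    intro v hv
    by_contra! hk
    exact absurd (csInf_le hbdd (show v ∈ H from ⟨⟨hv.1, hv.2.le.trans hτs⟩, hk⟩)) (not_le.2 hv.2)
  have hkτ : k ≤ N τ := by
    rcases hτs.eq_or_lt with h | h
    · rw [h]; exact hks
    · have h1 := hN.continuousWithinAt τ ⟨hr.trans hrτ, h.trans_le hs⟩
      -- Values are in the discrete space `ℕ`, so right-continuity means constancy just after `τ`;
      -- hence the infimum is attained.
      have h2 : ∀ᶠ v in 𝓝[≥] τ, N v = N τ := by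
        have := h1.tendsto (isOpen_discrete {N τ} |>.mem_nhds rfl)
        exact this
      obtain ⟨w, hw, hw'⟩ := (mem_nhdsGE_iff_exists_Ico_subset' h).1 h2
      obtain ⟨v, hv, hvw⟩ := exists_lt_of_csInf_lt ⟨s, hsH⟩ hw
      have : N v = N τ := hw' ⟨csInf_le hbdd hv, hvw⟩
      exact this ▸ hv.2
  have hrτ' : r < τ := by
    rcases hrτ.eq_or_lt with h | h
    · exact absurd hkτ (not_le.2 (h ▸ hrk))
    · exact h
  have hτT : τ ∈ Ioc t T := ⟨hr.trans_lt hrτ', hτs.trans hs⟩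
  obtain ⟨v, hv, hvN⟩ := hN.unit_jumps τ hτT
  -- Before `τ` the path is below `k`, and a unit jump cannot overshoot it.
  have hτk : N τ ≤ k := by
    have h1 : max v r ∈ Ico r τ := ⟨le_max_right _ _, max_lt hv.2 hrτ'⟩
    have h2 : N v ≤ N (max v r) := hN.monotoneOn ⟨hv.1, hv.2.le.trans hτT.2⟩
      ⟨hv.1.trans (le_max_left _ _), h1.2.le.trans hτT.2⟩ (le_max_left _ _)
    have := hlt _ h1
    omega
  have hNτ : N τ = k := le_antisymm hτk hkτ
  refine ⟨τ, ⟨hτT, fun w hw => ?_⟩, ⟨hrτ', hτs⟩, hNτ⟩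
  have h1 : max w r ∈ Ico r τ := ⟨le_max_right _ _, max_lt hw.2 hrτ'⟩
  have h2 : N w ≤ N (max w r) := hN.monotoneOn ⟨hw.1, hw.2.le.trans hτT.2⟩
    ⟨hw.1.trans (le_max_left _ _), h1.2.le.trans hτT.2⟩ (le_max_left _ _)
  have := hlt _ h1
  omega

/-- `N` itself is a bijection from the jump times in `(r, s]` onto the integers in `(N r, N s]`. -/
theorem encard_jumpTimes_inter_Ioc {N : ℝ≥0 → ℕ} {t T : ℝ≥0} (hN : IsCountingPath N t T) {r s : ℝ≥0} (hr : t ≤ r) (hrs : r ≤ s)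
    (hs : s ≤ T) : (jumpTimes N t T ∩ Ioc r s).encard = (N s - N r : ℕ) := by
  have hinj : InjOn N (jumpTimes N t T ∩ Ioc r s) :=
    (strictMonoOn_jumpTimes N t T).injOn.mono inter_subset_left
  have himg : N '' (jumpTimes N t T ∩ Ioc r s) = Ioc (N r) (N s) := by
    ext k
    constructor
    · rintro ⟨v, ⟨hv, hv'⟩, rfl⟩
      exact ⟨hv.2 r ⟨hr, hv'.1⟩, hN.monotoneOn ⟨hv.1.1.le, hv.1.2⟩ ⟨hr.trans hrs, hs⟩ hv'.2⟩
    · rintro ⟨h1, h2⟩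
      obtain ⟨v, hv, hv', hvk⟩ := exists_mem_jumpTimes_eq hN hr hs h1 h2 hrs
      exact ⟨v, ⟨hv, hv'⟩, hvk⟩
  rw [← hinj.encard_image, himg, ← Finset.coe_Ioc, Set.encard_coe_eq_coe_finsetCard, Nat.card_Ioc]

theorem jumpTimes_inter_Ioc_self (N : ℝ≥0 → ℕ) (t T : ℝ≥0) :
    jumpTimes N t T ∩ Ioc t T = jumpTimes N t T :=
  inter_eq_left.2 fun _ hs => hs.1

theorem finite_jumpTimes {N : ℝ≥0 → ℕ} {t T : ℝ≥0} (htT : t ≤ T) (hN : IsCountingPath N t T) : (jumpTimes N t T).Finite := by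
  rw [← encard_ne_top_iff, ← jumpTimes_inter_Ioc_self,
    encard_jumpTimes_inter_Ioc hN le_rfl htT le_rfl]
  exact ENat.natCast_ne_top _

theorem count_restrict_jumpTimes_Ioc {N : ℝ≥0 → ℕ} {t T : ℝ≥0} (hN : IsCountingPath N t T) {r s : ℝ≥0} (hr : t ≤ r) (hrs : r ≤ s)
    (hs : s ≤ T) :
    Measure.count.restrict (jumpTimes N t T) (Ioc r s) = ((N s - N r : ℕ) : ℝ≥0∞) := by
  have hfin := finite_jumpTimes (hr.trans (hrs.trans hs)) hN
  rw [Measure.restrict_apply measurableSet_Ioc, Measure.count_apply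
    (measurableSet_Ioc.inter hfin.measurableSet), inter_comm,
    encard_jumpTimes_inter_Ioc hN hr hrs hs]
  simp

theorem count_restrict_jumpTimes_congr (N : ℝ≥0 → ℕ) {t T : ℝ≥0} {E F : Set ℝ≥0}
    (hE : MeasurableSet E) (hF : MeasurableSet F) (h : E ∩ Ioc t T = F ∩ Ioc t T) :
    Measure.count.restrict (jumpTimes N t T) E = Measure.count.restrict (jumpTimes N t T) F := by
  have hJ : jumpTimes N t T = Ioc t T ∩ jumpTimes N t T := by
    rw [inter_comm, jumpTimes_inter_Ioc_self]
  rw [Measure.restrict_apply hE, Measure.restrict_apply hF, hJ, ← inter_assoc, h, inter_assoc]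

end Paths

/-! ### Approximation of paths on a grid -/

section Grid

/-- The points of the partition of `[t, T]` into `m + 1` intervals of equal length. -/
noncomputable def gridPoint (t T : ℝ≥0) (m j : ℕ) : ℝ≥0 := t + (T - t) * (j / (m + 1))

/-- The step function with the value `F j` on the `j`-th interval of the partition. -/
noncomputable def gridStep (t T : ℝ≥0) (m : ℕ) (F : ℕ → ℝ≥0∞) (s : ℝ≥0) : ℝ≥0∞ :=
  ∑ j ∈ Finset.range (m + 1),
    (Ioc (gridPoint t T m j) (gridPoint t T m (j + 1))).indicator (fun _ => F j) s

variable {t T : ℝ≥0}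

theorem gridPoint_zero (m : ℕ) : gridPoint t T m 0 = t := by simp [gridPoint]

theorem gridPoint_last (htT : t ≤ T) (m : ℕ) : gridPoint t T m (m + 1) = T := by
  have : ((m : ℝ≥0) + 1) / (m + 1) = 1 := div_self (by positivity)
  rw [gridPoint, Nat.cast_add, Nat.cast_one, this, mul_one, add_tsub_cancel_of_le htT]

theorem gridPoint_mono (m : ℕ) : Monotone (gridPoint t T m) := by
  intro i j hij
  unfold gridPoint
  gcongr

theorem le_gridPoint (m j : ℕ) : t ≤ gridPoint t T m j := le_self_add

theorem gridPoint_le (htT : t ≤ T) {m j : ℕ} (hj : j ≤ m + 1) : gridPoint t T m j ≤ T :=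
  (gridPoint_mono m hj).trans (gridPoint_last htT m).le

theorem gridPoint_succ (m j : ℕ) :
    gridPoint t T m (j + 1) = gridPoint t T m j + (T - t) / (m + 1) := by
  simp only [gridPoint, Nat.cast_add, Nat.cast_one, add_div, mul_add, mul_one_div, add_assoc]

theorem exists_mem_Ioc_gridPoint (htT : t ≤ T) (m : ℕ) {s : ℝ≥0} (hs : s ∈ Ioc t T) :
    ∃ j < m + 1, s ∈ Ioc (gridPoint t T m j) (gridPoint t T m (j + 1)) ∧
      ∀ F, gridStep t T m F s = F j := by
  classical
  have hex : ∃ j, s ≤ gridPoint t T m j := ⟨m + 1, hs.2.trans (gridPoint_last htT m).ge⟩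
  have h0 : Nat.find hex ≠ 0 := by
    intro h
    have := Nat.find_spec hex
    rw [h, gridPoint_zero] at this
    exact absurd hs.1 (not_lt.2 this)
  obtain ⟨j, hj⟩ := Nat.exists_eq_succ_of_ne_zero h0
  have hmem : s ∈ Ioc (gridPoint t T m j) (gridPoint t T m (j + 1)) := by
    refine ⟨not_le.1 (Nat.find_min hex (hj ▸ Nat.lt_succ_self j)), ?_⟩
    have := Nat.find_spec hex
    rwa [hj] at this
  have hjm : j < m + 1 := by
    have := Nat.find_min' hex (hs.2.trans (gridPoint_last htT m).ge)
    omega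
  refine ⟨j, hjm, hmem, fun F => ?_⟩
  rw [gridStep, Finset.sum_eq_single_of_mem j (Finset.mem_range.2 hjm), indicator_of_mem hmem]
  intro i _ hij
  refine indicator_of_notMem (fun hi => ?_) _
  exact disjoint_left.1 ((gridPoint_mono (t := t) (T := T) m).pairwise_disjoint_on_Ioc_succ hij)
    hi hmem

theorem tendsto_mesh : Tendsto (fun m : ℕ => (T - t) / ((m : ℝ≥0) + 1)) atTop (𝓝 0) := by
  have h1 : Tendsto (fun m : ℕ => ((m : ℝ≥0) + 1)) atTop atTop :=
    tendsto_atTop_mono (fun m => le_self_add) tendsto_natCast_atTop_atTop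
  simpa [div_eq_mul_inv] using (tendsto_inv_atTop_zero.comp h1).const_mul (T - t)

/-- The right endpoint of the cell containing `s` lies in `[s, T]`, within one mesh of `s`. -/
theorem tendsto_gridStep_right (htT : t ≤ T) {g : ℝ≥0 → ℝ≥0∞} {s : ℝ≥0} (hs : s ∈ Ioc t T)
    (hg : ContinuousWithinAt g (Icc s T) s) :
    Tendsto (fun m => gridStep t T m (fun j => g (gridPoint t T m (j + 1))) s) atTop (𝓝 (g s)) := by
  choose j hj hmem hF using fun m => exists_mem_Ioc_gridPoint htT m hs
  simp only [hF]
  refine hg.tendsto.comp (tendsto_nhdsWithin_iff.2 ⟨?_, Eventually.of_forall fun m =>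
    ⟨(hmem m).2, gridPoint_le htT (hj m)⟩⟩)
  refine tendsto_of_tendsto_of_tendsto_of_le_of_le (g := fun _ => s)
    (h := fun m : ℕ => s + (T - t) / ((m : ℝ≥0) + 1)) tendsto_const_nhds ?_ (fun m => (hmem m).2) ?_
  · simpa using (tendsto_mesh (t := t) (T := T)).const_add s
  · intro m
    simp only [gridPoint_succ]
    have := (hmem m).1.le
    gcongr

/-- The left endpoint of the cell lies strictly before `s`, within one mesh; its value is therefore
known in advance, which is what predictability requires. -/
theorem tendsto_gridStep_left (htT : t ≤ T) {g : ℝ≥0 → ℝ≥0∞} {s : ℝ≥0} (hs : s ∈ Ioc t T)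
    (hg : ContinuousWithinAt g (Iic s) s) :
    Tendsto (fun m => gridStep t T m (fun j => g (gridPoint t T m j)) s) atTop (𝓝 (g s)) := by
  choose j hj hmem hF using fun m => exists_mem_Ioc_gridPoint htT m hs
  simp only [hF]
  refine hg.tendsto.comp (tendsto_nhdsWithin_iff.2 ⟨?_, Eventually.of_forall fun m =>
    (hmem m).1.le⟩)
  refine tendsto_of_tendsto_of_tendsto_of_le_of_le (h := fun _ => s)
    (g := fun m : ℕ => s - (T - t) / ((m : ℝ≥0) + 1)) ?_ tendsto_const_nhds ?_ (fun m => (hmem m).1.le)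
  · simpa using (tendsto_const_nhds (x := s)).sub (tendsto_mesh (t := t) (T := T))
  · intro m
    rw [tsub_le_iff_right, ← gridPoint_succ]
    exact (hmem m).2

/-- A real function with left limits has at most countably many discontinuities from the left. -/
theorem countable_not_continuousWithinAt_Iic {t T : ℝ≥0} {f : ℝ≥0 → ℝ}
    (hf : ∀ s ∈ Ioc t T, ∃ l, Tendsto f (𝓝[<] s) (𝓝 l)) :
    {s | s ∈ Ioc t T ∧ ¬ContinuousWithinAt f (Iic s) s}.Countable := by
  obtain ⟨D, hDc, hDd⟩ := TopologicalSpace.exists_countable_dense ℝ≥0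
  -- At such a point a level `z` separates `f s` from all values on some interval `(q, s)` with `q`
  -- in a countable dense set; for each `q` only countably many points are separated in this way.
  have hsub : {s | s ∈ Ioc t T ∧ ¬ContinuousWithinAt f (Iic s) s} ⊆
      ⋃ q ∈ D, ({x ∈ Ioi q | ∃ z, z < f x ∧ ∀ y ∈ Ioi q, y < x → f y ≤ z} ∪
        {x ∈ Ioi q | ∃ z, f x < z ∧ ∀ y ∈ Ioi q, y < x → z ≤ f y}) := by
    rintro s ⟨hs, hns⟩
    obtain ⟨l, hl⟩ := hf s hs
    have hls : l ≠ f s := by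
      rintro rfl
      exact hns (continuousWithinAt_Iio_iff_Iic.1 hl)
    have hpt : ∀ p : ℝ → Prop, (∀ᶠ y in 𝓝 l, p y) → ∃ q ∈ D, q < s ∧ ∀ y ∈ Ioi q, y < s → p (f y) := by
      intro p hp
      obtain ⟨a, ha, has⟩ := (mem_nhdsLT_iff_exists_Ioo_subset' hs.1).1 (hl.eventually hp)
      obtain ⟨q, hqD, hq⟩ := hDd.exists_between ha
      exact ⟨q, hqD, hq.2, fun y hy hys => has ⟨hq.1.trans hy, hys⟩⟩
    rcases lt_or_gt_of_ne hls with h | h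
    · obtain ⟨z, hz1, hz2⟩ := exists_between h
      obtain ⟨q, hqD, hq, hqy⟩ := hpt (· ≤ z) ((eventually_lt_nhds hz1).mono fun _ h => h.le)
      exact mem_biUnion hqD (Or.inl ⟨hq, z, hz2, hqy⟩)
    · obtain ⟨z, hz1, hz2⟩ := exists_between h
      obtain ⟨q, hqD, hq, hqy⟩ := hpt (z ≤ ·) ((eventually_gt_nhds hz2).mono fun _ h => h.le)
      exact mem_biUnion hqD (Or.inr ⟨hq, z, hz1, hqy⟩)
  refine Countable.mono hsub (hDc.biUnion fun q _ => ?_)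
  exact (countable_image_lt_image_Iio_within _ f).union (countable_image_gt_image_Iio_within _ f)

theorem timeMeasure_countable {E : Set ℝ≥0} (hE : E.Countable) : timeMeasure E = 0 := by
  have hemb : MeasurableEmbedding ((↑) : ℝ≥0 → ℝ) :=
    MeasurableEmbedding.subtype_coe (measurableSet_Ici (a := (0 : ℝ)))
  rw [timeMeasure, hemb.comap_apply]
  exact (hE.image _).measure_zero _

end Grid

/-! ### Poisson arrivals -/

section Predictable

variable {Ω : Type*} {mΩ : MeasurableSpace Ω} {ℱ : Filtration ℝ≥0 mΩ} {n : ℕ} {t T : ℝ≥0}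

theorem predictable_le_prod (ℱ : Filtration ℝ≥0 mΩ) :
    ℱ.predictable ≤ (inferInstance : MeasurableSpace (ℝ≥0 × Ω)) :=
  measurableSpace_le_predictable_of_measurableSet
    (fun _ hA => (measurableSet_singleton _).prod (ℱ.le _ _ hA))
    (fun _ _ hA => measurableSet_Ioi.prod (ℱ.le _ _ hA))

/-- These sets generate the predictable σ-algebra; stability under intersection lets two finite
measures be compared on them. -/
theorem isPiSystem_predictable (ℱ : Filtration ℝ≥0 mΩ) :
    IsPiSystem ({s : Set (ℝ≥0 × Ω) | ∃ A, MeasurableSet[ℱ ⊥] A ∧ s = {⊥} ×ˢ A} ∪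
      {s | ∃ i A, MeasurableSet[ℱ i] A ∧ s = Ioi i ×ˢ A}) := by
  rintro _ (⟨A, hA, rfl⟩ | ⟨i, A, hA, rfl⟩) _ (⟨B, hB, rfl⟩ | ⟨j, B, hB, rfl⟩) hne
  · exact Or.inl ⟨A ∩ B, hA.inter hB, by rw [prod_inter_prod, inter_self]⟩
  · obtain ⟨⟨s, ω⟩, ⟨hs, _⟩, ⟨hs', _⟩⟩ := hne
    rw [mem_singleton_iff] at hs
    rw [hs] at hs'
    exact absurd (mem_Ioi.1 hs') not_lt_bot
  · obtain ⟨⟨s, ω⟩, ⟨hs', _⟩, ⟨hs, _⟩⟩ := hne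
    rw [mem_singleton_iff] at hs
    rw [hs] at hs'
    exact absurd (mem_Ioi.1 hs') not_lt_bot
  · exact Or.inr ⟨max i j, A ∩ B, (ℱ.mono (le_max_left i j) _ hA).inter
      (ℱ.mono (le_max_right i j) _ hB), by rw [prod_inter_prod, Ioi_inter_Ioi]⟩

theorem measurable_predictable_indicator {a b : ℝ≥0} {f : Ω → ℝ≥0∞} (hf : Measurable[ℱ a] f) :
    Measurable[ℱ.predictable] fun z : ℝ≥0 × Ω => (Ioc a b).indicator (fun _ => f z.2) z.1 := by
  classical
  intro V hV
  have h1 := measurableSet_predictable_Ioc_prod (𝓕 := ℱ) a b (hf hV)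
  have h2 := measurableSet_predictable_Ioc_prod (𝓕 := ℱ) a b (@MeasurableSet.univ Ω (ℱ a))
  by_cases h0 : (0 : ℝ≥0∞) ∈ V
  · convert! h1.union h2.compl using 1
    ext ⟨s, ω⟩
    by_cases hs : s ∈ Ioc a b
    · simp only [mem_preimage, indicator_of_mem hs, mem_union, mem_prod, hs, true_and,
        mem_compl_iff, mem_univ, not_true_eq_false, or_false]
    · simp only [mem_preimage, indicator_of_notMem hs, mem_union, mem_prod, hs, false_and,
        mem_compl_iff, not_false_eq_true, or_true, h0]
  · convert! h1 using 1
    ext ⟨s, ω⟩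
    by_cases hs : s ∈ Ioc a b
    · simp only [mem_preimage, indicator_of_mem hs, mem_prod, hs, true_and]
    · simp only [mem_preimage, indicator_of_notMem hs, mem_prod, hs, false_and, h0]

/-- A predictable version of the left limits of `P` on `(t, T]`. -/
noncomputable def leftLimitProcess (P : CubeProcess Ω n) (t T : ℝ≥0) : CubeProcess Ω n :=
  -- `limsup` is measurable whether or not the grid values converge; `projIcc` serves to land in
  -- `unitInterval`.
  fun s ω i => projIcc 0 1 zero_le_one (limsup (fun m : ℕ =>
    gridStep t T m (fun j => ENNReal.ofReal (P (gridPoint t T m j) ω i)) s) atTop).toReal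

theorem isStronglyPredictable_leftLimitProcess {P : CubeProcess Ω n}
    (hP : ∀ s, Measurable[ℱ s] (P s)) : IsStronglyPredictable ℱ (leftLimitProcess P t T) := by
  have h1 : ∀ i, Measurable[ℱ.predictable] fun z : ℝ≥0 × Ω => limsup (fun m : ℕ =>
      gridStep t T m (fun j => ENNReal.ofReal (P (gridPoint t T m j) z.2 i)) z.1) atTop := by
    intro i
    refine Measurable.limsup (mδ := ℱ.predictable) fun m => ?_
    refine Finset.measurable_fun_sum _ fun j _ => ?_
    exact measurable_predictable_indicator ((measurable_ofReal_coord i).comp (hP _))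
  have h2 : Measurable[ℱ.predictable] (Function.uncurry (leftLimitProcess P t T)) := by
    refine @measurable_pi_lambda _ _ _ ℱ.predictable _ _ fun i => ?_
    exact continuous_projIcc.measurable.comp (h1 i).ennreal_toReal
  exact h2.stronglyMeasurable

theorem leftLimitProcess_eq (htT : t ≤ T) {P : CubeProcess Ω n} {s : ℝ≥0} (hs : s ∈ Ioc t T) {ω : Ω}
    {i : Fin n} (hc : ContinuousWithinAt (fun r => P r ω i) (Iic s) s) :
    leftLimitProcess P t T s ω i = P s ω i := by
  have h1 : ContinuousWithinAt (fun r => ENNReal.ofReal (P r ω i)) (Iic s) s :=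
    (ENNReal.continuous_ofReal.comp continuous_subtype_val).continuousAt.comp_continuousWithinAt hc
  rw [leftLimitProcess, (tendsto_gridStep_left htT hs h1).limsup_eq,
    ENNReal.toReal_ofReal (P s ω i).2.1]
  exact projIcc_val zero_le_one _

theorem measurable_of_isStronglyPredictable {u : CubeProcess Ω n} (hu : IsStronglyPredictable ℱ u) :
    Measurable fun z : Ω × ℝ≥0 => u z.2 z.1 := by
  have h1 : Measurable[ℱ.predictable] (Function.uncurry u) := hu.measurable
  exact (h1.mono (predictable_le_prod ℱ) le_rfl).comp measurable_swap

/-- A path with left limits is left-continuous outside a countable, hence Lebesgue-null, set of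
times. -/
theorem ae_leftLimitProcess_eq {μ : Measure Ω} [IsProbabilityMeasure μ] (htT : t ≤ T)
    {P : CubeProcess Ω n} (hP : IsStronglyProgressive ℱ P) (hc : IsCadlagOn μ P t T) :
    ∀ᵐ z ∂μ.prod (timeMeasure.restrict (Ioc t T)), leftLimitProcess P t T z.2 z.1 = P z.2 z.1 := by
  have := isFiniteMeasure_timeMeasure_Ioc t T
  have hL : Measurable fun z : Ω × ℝ≥0 => leftLimitProcess P t T z.2 z.1 :=
    measurable_of_isStronglyPredictable (isStronglyPredictable_leftLimitProcess (ℱ := ℱ)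
      fun s => (hP.stronglyAdapted s).measurable)
  have h1 : ∀ᵐ z ∂μ.prod (timeMeasure.restrict (Ioc t T)),
      leftLimitProcess P t T z.2 z.1 = P (min z.2 T) z.1 := by
    rw [Measure.ae_prod_iff_ae_ae (measurableSet_eq_fun hL (measurable_min_of_isStronglyProgressive hP T))]
    filter_upwards [hc] with ω hω
    have hcount : ∀ i, ∀ᵐ s ∂timeMeasure.restrict (Ioc t T),
        ¬(s ∈ Ioc t T ∧ ¬ContinuousWithinAt (fun r => (P r ω i : ℝ)) (Iic s) s) := fun i => by
      refine ae_restrict_of_ae (measure_eq_zero_iff_ae_notMem.1 (timeMeasure_countable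
        (countable_not_continuousWithinAt_Iic fun s hs => ?_)))
      obtain ⟨l, hl⟩ := hω.2 s hs
      exact ⟨l i, (continuous_subtype_val.tendsto _).comp ((continuous_apply i).tendsto _ |>.comp hl)⟩
    filter_upwards [ae_all_iff.2 hcount, ae_restrict_mem measurableSet_Ioc] with s h2 hs
    rw [min_eq_left hs.2]
    funext i
    refine leftLimitProcess_eq htT hs ?_
    have h3 : ContinuousWithinAt (fun r => (P r ω i : ℝ)) (Iic s) s := by
      by_contra h
      exact h2 i ⟨hs, h⟩
    exact Topology.IsInducing.subtypeVal.continuousWithinAt_iff.2 h3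
  filter_upwards [h1, ae_prod_mem_Ioc t T] with z hz hzT
  rw [hz, min_eq_left hzT.2]

end Predictable

/-! ### The random measure of the jumps -/

section Counting

variable {Ω : Type*} {mΩ : MeasurableSpace Ω} {μ : Measure Ω} {t T : ℝ≥0}

/-- The jumps of a counting process form a random measure. -/
theorem exists_kernel_jumpTimes (htT : t ≤ T) {N : ℝ≥0 → Ω → ℕ} (hN : ∀ s, Measurable (N s))
    (hpath : ∀ᵐ ω ∂μ, IsCountingPath (fun s => N s ω) t T) :
    ∃ κ : Kernel Ω ℝ≥0, IsSFiniteKernel κ ∧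
      ∀ᵐ ω ∂μ, κ ω = Measure.count.restrict (jumpTimes (fun s => N s ω) t T) := by
  classical
  let B := {ω | ¬IsCountingPath (fun s => N s ω) t T}
  -- The good paths need not form a measurable set, so the kernel is set to zero off a measurable
  -- set of full measure consisting of good paths.
  let G := (toMeasurable μ B)ᶜ
  have hG : ∀ᵐ ω ∂μ, ω ∈ G := by
    have h0 : μ (toMeasurable μ B) = 0 := (measure_toMeasurable B).trans (ae_iff.1 hpath)
    exact measure_eq_zero_iff_ae_notMem.1 h0
  have hGm : MeasurableSet G := (measurableSet_toMeasurable _ _).compl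
  have hGp : ∀ ω ∈ G, IsCountingPath (fun s => N s ω) t T := fun ω hω => by
    by_contra h
    exact hω (subset_toMeasurable μ B h)
  let K : Ω → Measure ℝ≥0 := fun ω =>
    if ω ∈ G then Measure.count.restrict (jumpTimes (fun s => N s ω) t T) else 0
  have huniv : ∀ ω, K ω univ = if ω ∈ G then ((N T ω - N t ω : ℕ) : ℝ≥0∞) else 0 := by
    intro ω
    by_cases hω : ω ∈ G
    · simp only [K, if_pos hω]
      rw [count_restrict_jumpTimes_congr (F := Ioc t T) _ MeasurableSet.univ measurableSet_Ioc (by simp),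
        count_restrict_jumpTimes_Ioc (hGp ω hω) le_rfl htT le_rfl]
    · simp [K, hω]
  have hIic : ∀ ω a, K ω (Iic a)
      = if ω ∈ G then ((N (max t (min a T)) ω - N t ω : ℕ) : ℝ≥0∞) else 0 := by
    intro ω a
    by_cases hω : ω ∈ G
    · simp only [K, if_pos hω]
      rw [count_restrict_jumpTimes_congr (F := Ioc t (max t (min a T))) _ measurableSet_Iic
        measurableSet_Ioc, count_restrict_jumpTimes_Ioc (hGp ω hω) le_rfl (le_max_left _ _)
          (max_le htT (min_le_right _ _))]
      ext s
      simp only [mem_inter_iff, mem_Iic, mem_Ioc, le_max_iff, le_min_iff]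
      constructor
      · rintro ⟨h1, h2, h3⟩
        exact ⟨⟨h2, Or.inr ⟨h1, h3⟩⟩, h2, h3⟩
      · rintro ⟨⟨h1, h2 | h2⟩, -, h3⟩
        · exact absurd h2 (not_le.2 h1)
        · exact ⟨h2.1, h1, h3⟩
    · simp [K, hω]
  have hdiff : ∀ r s, Measurable fun ω => ((N r ω - N s ω : ℕ) : ℝ≥0∞) := fun r s =>
    measurable_from_nat.comp ((hN r).sub (hN s))
  have hfin : ∀ ω, IsFiniteMeasure (K ω) := fun ω => ⟨by
    rw [huniv]
    split_ifs
    · exact ENNReal.natCast_lt_top _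
    · exact ENNReal.zero_lt_top⟩
  have hunivm : Measurable fun ω => K ω univ := by
    simp only [huniv]
    exact Measurable.ite hGm (hdiff _ _) measurable_const
  -- Measurability is tested on half-lines, whose mass is an increment of `N`.
  have hK : Measurable K := by
    have hb : (inferInstance : MeasurableSpace ℝ≥0) = MeasurableSpace.generateFrom (range Iic) := by
      rw [← borel_eq_generateFrom_Iic]; exact BorelSpace.measurable_eq
    refine Measurable.measure_of_isPiSystem hb isPiSystem_Iic ?_ hunivm
    rintro _ ⟨a, rfl⟩
    simp only [hIic]
    exact Measurable.ite hGm (hdiff _ _) measurable_const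
  -- Sorting `ω` by the total number of jumps splits the kernel into pieces of bounded mass, as
  -- s-finiteness demands.
  let κs : ℕ → Kernel Ω ℝ≥0 := fun m =>
    ⟨fun ω => if K ω univ = m then K ω else 0,
      Measurable.ite (hunivm (measurableSet_singleton _)) hK measurable_const⟩
  have hκs : ∀ m ω, κs m ω = if K ω univ = m then K ω else 0 := fun m ω => rfl
  refine ⟨⟨K, hK⟩, ⟨κs, fun m => ⟨m, ENNReal.natCast_lt_top m, fun ω => ?_⟩, ?_⟩, ?_⟩
  · rw [hκs]
    split_ifs with h
    · exact h.le
    · simp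
  · ext ω E hE
    rw [Kernel.sum_apply' _ _ hE]
    obtain ⟨m, hm⟩ : ∃ m : ℕ, K ω univ = m := by
      rw [huniv]
      split_ifs
      · exact ⟨_, rfl⟩
      · exact ⟨0, by simp⟩
    rw [tsum_eq_single m]
    · rw [hκs, if_pos hm]; rfl
    · intro k hk
      rw [hκs, if_neg]
      · simp
      · rw [hm]
        exact fun h => hk (Nat.cast_injective h).symm
  · filter_upwards [hG] with ω hω
    exact if_pos hω

end Counting

/-! ### Compensation formula and expected liabilities -/

section Poisson

variable {Ω : Type*} {mΩ : MeasurableSpace Ω} {μ : Measure Ω}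
  {ℱ : Filtration ℝ≥0 mΩ} {n : ℕ} {t T : ℝ≥0} {A : Fin n → Set Ω} {P u : CubeProcess Ω n}
  {lam : Fin n → Cube n → Cube n → ℝ≥0∞} {X : Ω → ℝ} {Q : Ω → Fin n → ℝ}
  {N : Fin n → ℝ≥0 → Ω → ℕ}

theorem IsControlledPoisson.ae_isCountingPath (hN : IsControlledPoisson μ ℱ lam P t T u N)
    (i : Fin n) : ∀ᵐ ω ∂μ, IsCountingPath (fun s => N i s ω) t T := by
  filter_upwards [hN.monotone i, hN.right_continuous i, hN.unit_jumps i] with ω h1 h2 h3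
  exact ⟨h1, h2, h3⟩

theorem IsControlledPoisson.exists_kernel (hN : IsControlledPoisson μ ℱ lam P t T u N)
    (htT : t ≤ T) (i : Fin n) : ∃ κ : Kernel Ω ℝ≥0, IsSFiniteKernel κ ∧
      ∀ᵐ ω ∂μ, κ ω = poissonArrivals N t T i ω :=
  exists_kernel_jumpTimes htT (fun s => (hN.adapted i s).mono (ℱ.le s) le_rfl)
    (hN.ae_isCountingPath i)

theorem IsControlledPoisson.aemeasurable_lintegral (hN : IsControlledPoisson μ ℱ lam P t T u N)
    (htT : t ≤ T) (i : Fin n) {w : Ω × ℝ≥0 → ℝ≥0∞} (hw : Measurable w) :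
    AEMeasurable (fun ω => ∫⁻ s, w (ω, s) ∂poissonArrivals N t T i ω) μ := by
  obtain ⟨κ, hκ, hκN⟩ := hN.exists_kernel htT i
  refine AEMeasurable.congr (f := fun ω => ∫⁻ s, w (ω, s) ∂κ ω)
    hw.lintegral_kernel_prod_right'.aemeasurable ?_
  filter_upwards [hκN] with ω h
  rw [h]

/-- The intensity property in the form used on generators of the predictable σ-algebra, whose time
sections matter only through their trace on `(t, T]`. -/
theorem IsControlledPoisson.setLIntegral_arrivals (hN : IsControlledPoisson μ ℱ lam P t T u N)
    (i : Fin n) {r : ℝ≥0} (hr : t ≤ r) (hrT : r ≤ T) {E : Set ℝ≥0} (hE : MeasurableSet E)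
    (hEr : E ∩ Ioc t T = Ioc r T) {B : Set Ω} (hB : MeasurableSet[ℱ r] B) :
    ∫⁻ ω in B, poissonArrivals N t T i ω E ∂μ
      = ∫⁻ ω in B, ∫⁻ s in E ∩ Ioc t T, lam i (P s ω) (u s ω) ∂timeMeasure ∂μ := by
  rw [hEr, ← hN.intensity i r T hr hrT le_rfl B hB]
  refine lintegral_congr_ae (ae_restrict_of_ae ?_)
  filter_upwards [hN.ae_isCountingPath i] with ω hω
  rw [poissonArrivals, count_restrict_jumpTimes_congr _ hE measurableSet_Ioc (F := Ioc r T),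
    count_restrict_jumpTimes_Ioc hω hr hrT le_rfl]
  rw [hEr]
  exact (inter_eq_left.2 (Ioc_subset_Ioc_left hr)).symm

theorem ae_mem_jumpTimes_poissonArrivals {i : Fin n} {ω : Ω}
    (hω : IsCountingPath (fun s => N i s ω) t T) (htT : t ≤ T) :
    ∀ᵐ s ∂poissonArrivals N t T i ω, s ∈ jumpTimes (fun s => N i s ω) t T :=
  ae_restrict_mem (finite_jumpTimes htT hω).measurableSet

theorem lintegral_gridStep_poissonArrivals (htT : t ≤ T) {i : Fin n} {ω : Ω}
    (hω : IsCountingPath (fun s => N i s ω) t T) (m : ℕ) (F : ℕ → ℝ≥0∞) :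
    ∫⁻ s, gridStep t T m F s ∂poissonArrivals N t T i ω
      = ∑ j ∈ Finset.range (m + 1), F j
        * ((N i (gridPoint t T m (j + 1)) ω - N i (gridPoint t T m j) ω : ℕ) : ℝ≥0∞) := by
  simp only [gridStep]
  rw [lintegral_finsetSum _ fun j _ => measurable_const.indicator measurableSet_Ioc]
  refine Finset.sum_congr rfl fun j hj => ?_
  rw [lintegral_indicator_const measurableSet_Ioc, poissonArrivals,
    count_restrict_jumpTimes_Ioc hω (le_gridPoint m j) (gridPoint_mono m (Nat.le_succ j))
      (gridPoint_le htT (Finset.mem_range.1 hj))]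

theorem IsControlledPoisson.lintegral_mass_ne_top (hN : IsControlledPoisson μ ℱ lam P t T u N)
    (htT : t ≤ T) (hfeb : FiniteExpectedBets μ lam P t T u) (i : Fin n) :
    ∫⁻ ω, poissonArrivals N t T i ω univ ∂μ ≠ ∞ := by
  have h1 := hN.setLIntegral_arrivals i le_rfl htT MeasurableSet.univ (univ_inter _)
    (@MeasurableSet.univ Ω (ℱ t))
  rw [Measure.restrict_univ, univ_inter] at h1
  rw [h1]
  exact hfeb i

variable [IsProbabilityMeasure μ]

/-- The compensation formula: the arrivals of bets have the predictable intensity `λ_i(P_s, u_s)`. -/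
theorem IsControlledPoisson.lintegral_predictable (hN : IsControlledPoisson μ ℱ lam P t T u N)
    (htT : t ≤ T) (hP : IsStronglyProgressive ℱ P) (hu : IsStronglyPredictable ℱ u)
    (hlam : ∀ i, Measurable fun z : Cube n × Cube n => lam i z.1 z.2)
    (hfeb : FiniteExpectedBets μ lam P t T u) (i : Fin n) {w : ℝ≥0 × Ω → ℝ≥0∞}
    (hw : Measurable[ℱ.predictable] w) :
    ∫⁻ ω, ∫⁻ s, w (s, ω) ∂poissonArrivals N t T i ω ∂μ
      = ∫⁻ ω, ∫⁻ s in Ioc t T, w (s, ω) * lam i (P s ω) (u s ω) ∂timeMeasure ∂μ := by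
  have := isFiniteMeasure_timeMeasure_Ioc t T
  obtain ⟨κ, hκ, hκN⟩ := hN.exists_kernel htT i
  set θ := timeMeasure.restrict (Ioc t T) with hθ
  have hle := predictable_le_prod ℱ
  have hwm : Measurable w := hw.mono hle le_rfl
  let g : Ω × ℝ≥0 → ℝ≥0∞ := fun z => lam i (P (min z.2 T) z.1) (u (min z.2 T) z.1)
  have hg : Measurable g := (hlam i).comp ((measurable_min_of_isStronglyProgressive hP T).prodMk
    (measurable_min_of_isStronglyProgressive hu.isStronglyProgressive T))
  have hgs : ∀ ω, ∀ s ∈ Ioc t T, g (ω, s) = lam i (P s ω) (u s ω) := fun ω s hs => by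
    simp only [g, min_eq_left hs.2]
  -- `ν₁` is the expected arrival measure on time × `Ω` and `ν₂` that of its compensator; the
  -- formula says that they agree on the predictable σ-algebra.
  let ν₁ : Measure (ℝ≥0 × Ω) := (μ ⊗ₘ κ).map Prod.swap
  let ν₂ : Measure (ℝ≥0 × Ω) := ((μ.prod θ).withDensity g).map Prod.swap
  have hν₁ : ∀ E B, MeasurableSet E → MeasurableSet B →
      ν₁ (E ×ˢ B) = ∫⁻ ω in B, poissonArrivals N t T i ω E ∂μ := by
    intro E B hE hB
    rw [Measure.map_apply measurable_swap (hE.prod hB), preimage_swap_prod,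
      Measure.compProd_apply_prod hB hE]
    refine lintegral_congr_ae (ae_restrict_of_ae ?_)
    filter_upwards [hκN] with ω h
    rw [h]
  have hν₂ : ∀ E B, MeasurableSet E → MeasurableSet B →
      ν₂ (E ×ˢ B) = ∫⁻ ω in B, ∫⁻ s in E ∩ Ioc t T, lam i (P s ω) (u s ω) ∂timeMeasure ∂μ := by
    intro E B hE hB
    rw [Measure.map_apply measurable_swap (hE.prod hB), preimage_swap_prod,
      withDensity_apply _ (hB.prod hE), ← Measure.prod_restrict, lintegral_prod _ hg.aemeasurable,
      hθ, Measure.restrict_restrict hE]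
    refine lintegral_congr fun ω => setLIntegral_congr_fun (hE.inter measurableSet_Ioc) ?_
    exact fun s hs => hgs ω s hs.2
  have hkey : ∀ r, t ≤ r → r ≤ T → ∀ E B, MeasurableSet E → E ∩ Ioc t T = Ioc r T →
      MeasurableSet[ℱ r] B → ν₁ (E ×ˢ B) = ν₂ (E ×ˢ B) := by
    intro r hr hrT E B hE hEr hB
    rw [hν₁ E B hE (ℱ.le r _ hB), hν₂ E B hE (ℱ.le r _ hB)]
    exact hN.setLIntegral_arrivals i hr hrT hE hEr hB
  have huniv : ν₁ univ = ν₂ univ := by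
    rw [← univ_prod_univ]
    exact hkey t le_rfl htT univ univ MeasurableSet.univ (univ_inter _) MeasurableSet.univ
  have hfin : IsFiniteMeasure (ν₁.trim hle) := ⟨by
    rw [trim_measurableSet_eq hle MeasurableSet.univ, huniv, ← univ_prod_univ,
      hν₂ _ _ MeasurableSet.univ MeasurableSet.univ, univ_inter, Measure.restrict_univ]
    exact (hfeb i).lt_top⟩
  have htrim : ν₁.trim hle = ν₂.trim hle := by
    refine @ext_of_generate_finite _ ℱ.predictable _ _ _ rfl (isPiSystem_predictable ℱ) hfin ?_ ?_
    · rintro _ (⟨B, hB, rfl⟩ | ⟨r, B, hB, rfl⟩)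
      · rw [trim_measurableSet_eq hle (measurableSet_predictable_singleton_bot_prod hB),
          trim_measurableSet_eq hle (measurableSet_predictable_singleton_bot_prod hB)]
        -- Time zero is not in `(t, T]`, so this is the case of the empty interval `(T, T]`.
        refine hkey T htT le_rfl _ _ (measurableSet_singleton _) ?_ (ℱ.mono bot_le _ hB)
        rw [Ioc_self]
        exact disjoint_iff_inter_eq_empty.1 (disjoint_singleton_left.2 fun h => not_lt_bot h.1)
      · rw [trim_measurableSet_eq hle (measurableSet_predictable_Ioi_prod hB),
          trim_measurableSet_eq hle (measurableSet_predictable_Ioi_prod hB)]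
        rcases le_or_gt r T with hrT | hrT
        · refine hkey (max r t) (le_max_right _ _) (max_le hrT htT) _ _ measurableSet_Ioi ?_
            (ℱ.mono (le_max_left _ _) _ hB)
          ext s
          simp only [mem_inter_iff, mem_Ioi, mem_Ioc, max_lt_iff, and_assoc]
        -- Here `B` need not belong to `ℱ T`, so `hkey` is applied to `univ` and both measures
        -- vanish by monotonicity.
        · have hBm := ℱ.le r _ hB
          have hE : Ioi r ∩ Ioc t T = Ioc T T := by
            rw [Ioc_self]
            refine disjoint_iff_inter_eq_empty.1 (disjoint_left.2 fun s hs hs' => ?_)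
            exact absurd (hs'.2.trans_lt hrT) (not_lt.2 (le_of_lt hs))
          have h1 := hkey T htT le_rfl (Ioi r) univ measurableSet_Ioi hE MeasurableSet.univ
          have h2 : ν₂ (Ioi r ×ˢ univ) = 0 := by
            rw [hν₂ _ _ measurableSet_Ioi MeasurableSet.univ, hE]
            simp
          rw [measure_mono_null (prod_mono_right (subset_univ B)) (h1.trans h2),
            measure_mono_null (prod_mono_right (subset_univ B)) h2]
    · rw [trim_measurableSet_eq hle MeasurableSet.univ, trim_measurableSet_eq hle MeasurableSet.univ,
        huniv]
  calc ∫⁻ ω, ∫⁻ s, w (s, ω) ∂poissonArrivals N t T i ω ∂μ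
      = ∫⁻ ω, ∫⁻ s, w (s, ω) ∂κ ω ∂μ := lintegral_congr_ae (hκN.mono fun ω h => by simp only [h])
    _ = ∫⁻ z, w z ∂ν₁ := by
        have hws : Measurable fun z : Ω × ℝ≥0 => w z.swap := hwm.comp measurable_swap
        rw [lintegral_map hwm measurable_swap, Measure.lintegral_compProd hws]
        rfl
    _ = ∫⁻ z, w z ∂ν₂ := by rw [← lintegral_trim hle hw, htrim, lintegral_trim hle hw]
    _ = ∫⁻ ω, ∫⁻ s, g (ω, s) * w (s, ω) ∂θ ∂μ := by
        have hws : Measurable fun z : Ω × ℝ≥0 => w z.swap := hwm.comp measurable_swap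
        rw [lintegral_map hwm measurable_swap, lintegral_withDensity_eq_lintegral_mul _ hg hws,
          lintegral_prod _ (hg.mul hws).aemeasurable]
        rfl
    _ = ∫⁻ ω, ∫⁻ s in Ioc t T, w (s, ω) * lam i (P s ω) (u s ω) ∂timeMeasure ∂μ := by
        refine lintegral_congr fun ω => setLIntegral_congr_fun measurableSet_Ioc fun s hs => ?_
        simp only [hgs ω s hs, mul_comm]

/-- For an event `B` known at time `t`, the set `(t, ∞) × B` is predictable, so its indicator can be
absorbed into `w`. -/
theorem IsControlledPoisson.setLIntegral_predictable (hN : IsControlledPoisson μ ℱ lam P t T u N)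
    (htT : t ≤ T) (hP : IsStronglyProgressive ℱ P) (hu : IsStronglyPredictable ℱ u)
    (hlam : ∀ i, Measurable fun z : Cube n × Cube n => lam i z.1 z.2)
    (hfeb : FiniteExpectedBets μ lam P t T u) (i : Fin n) {w : ℝ≥0 × Ω → ℝ≥0∞}
    (hw : Measurable[ℱ.predictable] w) {B : Set Ω} (hB : MeasurableSet[ℱ t] B) :
    ∫⁻ ω in B, ∫⁻ s, w (s, ω) ∂poissonArrivals N t T i ω ∂μ
      = ∫⁻ ω in B, ∫⁻ s in Ioc t T, w (s, ω) * lam i (P s ω) (u s ω) ∂timeMeasure ∂μ := by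
  have hBm : MeasurableSet B := ℱ.le t _ hB
  have h1 := hN.lintegral_predictable htT hP hu hlam hfeb i
    (hw.indicator (measurableSet_predictable_Ioi_prod hB))
  have h2 : ∀ ω s, s ∈ Ioc t T → (Ioi t ×ˢ B).indicator w (s, ω) = B.indicator (fun ω => w (s, ω)) ω := by
    intro ω s hs
    have : (s, ω) ∈ Ioi t ×ˢ B ↔ ω ∈ B := ⟨fun h => h.2, fun h => ⟨hs.1, h⟩⟩
    by_cases h : ω ∈ B
    · rw [indicator_of_mem (this.2 h), indicator_of_mem h]
    · rw [indicator_of_notMem (this.not.2 h), indicator_of_notMem h]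
  rw [← lintegral_indicator hBm, ← lintegral_indicator hBm]
  refine Eq.trans (Eq.trans (lintegral_congr_ae ?_) h1) (lintegral_congr fun ω => ?_)
  · filter_upwards [hN.ae_isCountingPath i] with ω hω
    have h3 : ∫⁻ s, (Ioi t ×ˢ B).indicator w (s, ω) ∂poissonArrivals N t T i ω
        = ∫⁻ s, B.indicator (fun ω => w (s, ω)) ω ∂poissonArrivals N t T i ω :=
      lintegral_congr_ae ((ae_mem_jumpTimes_poissonArrivals hω htT).mono fun s hs => h2 ω s hs.1)
    rw [h3]
    by_cases h : ω ∈ B <;> simp [h]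
  · rw [setLIntegral_congr_fun (g := fun s => B.indicator (fun ω => w (s, ω)) ω
      * lam i (P s ω) (u s ω)) measurableSet_Ioc fun s hs => by simp only [h2 ω s hs]]
    by_cases h : ω ∈ B <;> simp [h]

/-- The expected liabilities: the outcome may be replaced by its conditional probability at the
times of arrival. -/
theorem IsControlledPoisson.setLIntegral_outcome (hN : IsControlledPoisson μ ℱ lam P t T u N)
    (htT : t ≤ T) (hP : IsConditionalProbability μ ℱ T A P) (hc : IsCadlagOn μ P t T)
    (hfeb : FiniteExpectedBets μ lam P t T u) (i : Fin n) {B : Set Ω} (hB : MeasurableSet[ℱ t] B) :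
    ∫⁻ ω in A i ∩ B, poissonArrivals N t T i ω univ ∂μ
      = ∫⁻ ω in B, ∫⁻ s, ENNReal.ofReal (P s ω i) ∂poissonArrivals N t T i ω ∂μ := by
  have hPm : ∀ s, Measurable fun ω => ENNReal.ofReal (P s ω i) := fun s =>
    (measurable_ofReal_coord i).comp ((hP.measurable_at s).mono (ℱ.le s) le_rfl)
  have hpath := hN.ae_isCountingPath i
  let Δ : ℕ → ℕ → Ω → ℝ≥0∞ := fun m j ω =>
    ((N i (gridPoint t T m (j + 1)) ω - N i (gridPoint t T m j) ω : ℕ) : ℝ≥0∞)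
  have hΔ : ∀ m j, Measurable[ℱ (gridPoint t T m (j + 1))] (Δ m j) := fun m j =>
    measurable_from_nat.comp ((hN.adapted i _).sub
      ((hN.adapted i _).mono (ℱ.mono (gridPoint_mono m (Nat.le_succ j))) le_rfl))
  have hΔm : ∀ m j, Measurable (Δ m j) := fun m j => (hΔ m j).mono (ℱ.le _) le_rfl
  -- The number of arrivals in a grid interval is known at its right endpoint, where the outcome is
  -- replaced by its conditional probability. Conditioning at the left endpoint would not be
  -- possible.
  have hstep : ∀ m, ∫⁻ ω in A i ∩ B, poissonArrivals N t T i ω univ ∂μ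
      = ∫⁻ ω in B, ∑ j ∈ Finset.range (m + 1),
          ENNReal.ofReal (P (gridPoint t T m (j + 1)) ω i) * Δ m j ω ∂μ := by
    intro m
    have h1 : ∀ᵐ ω ∂μ, poissonArrivals N t T i ω univ = ∑ j ∈ Finset.range (m + 1), Δ m j ω := by
      filter_upwards [hpath] with ω hω
      have h2 := lintegral_gridStep_poissonArrivals htT hω m fun _ => 1
      simp only [one_mul] at h2
      rw [← h2, ← lintegral_one]
      refine lintegral_congr_ae ((ae_mem_jumpTimes_poissonArrivals hω htT).mono fun s hs => ?_)
      obtain ⟨j, _, _, hj⟩ := exists_mem_Ioc_gridPoint htT m hs.1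
      rw [hj]
    have h2 := lintegral_finsetSum (μ := μ.restrict B) (Finset.range (m + 1))
      (f := fun j ω => ENNReal.ofReal (P (gridPoint t T m (j + 1)) ω i) * Δ m j ω)
      fun j _ => (hPm _).mul (hΔm m j)
    rw [lintegral_congr_ae (ae_restrict_of_ae h1), lintegral_finsetSum _ fun j _ => hΔm m j, h2]
    refine Finset.sum_congr rfl fun j hj => ?_
    exact hP.setLIntegral_inter_eq (gridPoint_le htT (Finset.mem_range.1 hj)) i (hΔ m j)
      (ℱ.mono (le_gridPoint m _) _ hB)
  -- Right endpoints decrease to within any distance of each of the finitely many jump times, so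
  -- right-continuity of `P` gives the limit; the total number of jumps dominates.
  have hlim : Tendsto (fun m => ∫⁻ ω in B, ∑ j ∈ Finset.range (m + 1),
      ENNReal.ofReal (P (gridPoint t T m (j + 1)) ω i) * Δ m j ω ∂μ) atTop
      (𝓝 (∫⁻ ω in B, ∫⁻ s, ENNReal.ofReal (P s ω i) ∂poissonArrivals N t T i ω ∂μ)) := by
    refine tendsto_lintegral_of_dominated_convergence (fun ω => poissonArrivals N t T i ω univ)
      (fun m => Finset.measurable_fun_sum _ fun j _ => (hPm _).mul (hΔm m j)) ?_ ?_ ?_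
    · intro m
      refine ae_restrict_of_ae ?_
      filter_upwards [hpath] with ω hω
      rw [← lintegral_gridStep_poissonArrivals htT hω m fun j =>
        ENNReal.ofReal (P (gridPoint t T m (j + 1)) ω i), ← lintegral_one]
      refine lintegral_mono_ae ((ae_mem_jumpTimes_poissonArrivals hω htT).mono fun s hs => ?_)
      obtain ⟨j, _, _, hj⟩ := exists_mem_Ioc_gridPoint htT m hs.1
      rw [hj]
      exact ENNReal.ofReal_le_one.2 (P _ ω i).2.2
    · exact ne_top_of_le_ne_top (hN.lintegral_mass_ne_top htT hfeb i) (setLIntegral_le_lintegral _ _)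
    · refine ae_restrict_of_ae ?_
      filter_upwards [hpath, hc] with ω hω hcω
      have hfin := finite_jumpTimes htT hω
      obtain ⟨J, hJ⟩ := hfin.exists_finset_coe
      have hsum : ∀ f : ℝ≥0 → ℝ≥0∞, ∫⁻ s, f s ∂poissonArrivals N t T i ω = ∑ s ∈ J, f s := by
        intro f
        rw [poissonArrivals, ← hJ, lintegral_finset]
        simp
      simp only [Δ, ← lintegral_gridStep_poissonArrivals htT hω _ fun j =>
        ENNReal.ofReal (P (gridPoint t T _ (j + 1)) ω i), hsum]
      refine tendsto_finsetSum _ fun s hs => ?_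
      have hsJ : s ∈ jumpTimes (fun s => N i s ω) t T := hJ ▸ Finset.mem_coe.2 hs
      refine tendsto_gridStep_right htT (g := fun s => ENNReal.ofReal (P s ω i)) hsJ.1 ?_
      rcases hsJ.1.2.eq_or_lt with h | h
      · rw [h, Icc_self]
        exact continuousWithinAt_singleton
      · have h1 : ContinuousWithinAt (fun r => P r ω) (Icc s T) s :=
          (hcω.1 s ⟨hsJ.1.1.le, h⟩).mono Icc_subset_Ici_self
        have h2 : Continuous fun p : Cube n => ENNReal.ofReal (p i) :=
          ENNReal.continuous_ofReal.comp (continuous_subtype_val.comp (continuous_apply i))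
        exact h2.continuousAt.comp_continuousWithinAt h1
  refine tendsto_nhds_unique ?_ hlim
  simp only [← hstep]
  exact tendsto_const_nhds

/-- For the liabilities, `P i` is replaced by its predictable left-limit version at the jump times,
the compensation formula is applied, and `P i` is restored for almost every time. The first
replacement uses the absence of common jumps. -/
theorem exists_cashFlow_poissonArrivals (htT : t ≤ T) (hP : IsConditionalProbability μ ℱ T A P)
    (hlam : ∀ i, Measurable fun z : Cube n × Cube n => lam i z.1 z.2) (hc : IsCadlagOn μ P t T)
    (hu : IsStronglyPredictable ℱ u) (hfeb : FiniteExpectedBets μ lam P t T u)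
    (hN : IsControlledPoisson μ ℱ lam P t T u N) (hNP : NoCommonJumps μ P t T N) :
    ∃ C : Ω → ℝ, Integrable C μ ∧
      (terminalWealth A X Q (poissonArrivals N t T) u
        =ᵐ[μ] fun ω => X ω - ∑ i, Q ω i * (A i).indicator (fun _ => (1 : ℝ)) ω + C ω) ∧
      ∀ B, MeasurableSet[ℱ t] B → ∫ ω in B, C ω ∂μ
        = ∫ ω in B, ∫ s in Ioc t T, profitRate lam (P s ω) (u s ω) ∂timeMeasure ∂μ := by
  have := isFiniteMeasure_timeMeasure_Ioc t T
  have hA : ∀ i, MeasurableSet (A i) := fun i => ℱ.le T _ (hP.outcome_measurable i)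
  have hum := measurable_of_isStronglyPredictable hu
  have hup : Measurable[ℱ.predictable] (Function.uncurry u) := hu.measurable
  have hL : IsStronglyPredictable ℱ (leftLimitProcess P t T) :=
    isStronglyPredictable_leftLimitProcess hP.measurable_at
  have hLp : Measurable[ℱ.predictable] (Function.uncurry (leftLimitProcess P t T)) := hL.measurable
  refine exists_cashFlow (ℱ := ℱ) hlam (aemeasurable_of_isStronglyProgressive hP.progressive)
    hum.aemeasurable hfeb hA ?_ ?_ ?_ ?_ ?_ ?_
  · intro i
    simpa using hN.aemeasurable_lintegral htT i (w := fun _ => 1) measurable_const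
  · exact hN.lintegral_mass_ne_top htT hfeb
  · exact fun i => hN.aemeasurable_lintegral htT i ((measurable_ofReal_coord i).comp hum)
  · exact fun i => Eventually.of_forall fun ω =>
      ((measurable_coord i).comp (hum.comp measurable_prodMk_left)).aestronglyMeasurable
  · exact fun i B hB => hN.setLIntegral_predictable htT hP.progressive hu hlam hfeb i
      ((measurable_ofReal_coord i).comp hup) hB
  · intro i B hB
    rw [hN.setLIntegral_outcome htT hP hc hfeb i hB]
    have h1 := hN.setLIntegral_predictable htT hP.progressive hu hlam hfeb i
      ((measurable_ofReal_coord i).comp hLp) hB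
    refine Eq.trans (lintegral_congr_ae (ae_restrict_of_ae ?_))
      (h1.trans (lintegral_congr_ae (ae_restrict_of_ae ?_)))
    · filter_upwards [hN.ae_isCountingPath i, hNP i] with ω hω hPω
      refine lintegral_congr_ae ((ae_mem_jumpTimes_poissonArrivals hω htT).mono fun s hs => ?_)
      simp only [Function.comp_apply, Function.uncurry, leftLimitProcess_eq htT hs.1 (hPω s hs)]
    · filter_upwards [Measure.ae_ae_of_ae_prod (ae_leftLimitProcess_eq htT hP.progressive hc)] with ω hω
      refine lintegral_congr_ae (hω.mono fun s hs => ?_)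
      simp only [Function.comp_apply, Function.uncurry, hs]

end Poisson

/-! ### Stability of the strategy classes and conclusion -/

theorem isStronglyProgressive_comp {Ω : Type*} {mΩ : MeasurableSpace Ω} {ℱ : Filtration ℝ≥0 mΩ} {n : ℕ}
    {R u : CubeProcess Ω n} (hR : IsStronglyProgressive ℱ R) (hu : IsStronglyProgressive ℱ u)
    {G : Cube n × Cube n → Cube n} (hG : Measurable G) :
    IsStronglyProgressive ℱ fun s ω => G (R s ω, u s ω) := fun i =>
  (hG.comp ((hR i).measurable.prodMk (hu i).measurable)).stronglyMeasurable

theorem isStronglyPredictable_comp {Ω : Type*} {mΩ : MeasurableSpace Ω} {ℱ : Filtration ℝ≥0 mΩ} {n : ℕ}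
    {R u : CubeProcess Ω n} (hR : IsStronglyPredictable ℱ R) (hu : IsStronglyPredictable ℱ u)
    {G : Cube n × Cube n → Cube n} (hG : Measurable G) :
    IsStronglyPredictable ℱ fun s ω => G (R s ω, u s ω) := by
  have hR' : Measurable[ℱ.predictable] (Function.uncurry R) := hR.measurable
  have hu' : Measurable[ℱ.predictable] (Function.uncurry u) := hu.measurable
  exact (hG.comp (hR'.prodMk hu')).stronglyMeasurable

theorem mainTheorem2 {Ω : Type*} {mΩ : MeasurableSpace Ω} (μ : Measure Ω) [IsProbabilityMeasure μ]
    (ℱ : Filtration ℝ≥0 mΩ) (n : ℕ) (t T : ℝ≥0) (htT : t < T)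
    (A : Fin n → Set Ω) (P : CubeProcess Ω n) (hP : IsConditionalProbability μ ℱ T A P)
    (lam : Fin n → Cube n → Cube n → ℝ≥0∞)
    (hlam : ∀ i, Measurable (fun z : Cube n × Cube n => lam i z.1 z.2))
    (X : Ω → ℝ) (hX : Measurable[ℱ t] X) (Q : Ω → Fin n → ℝ) (hQ : Measurable[ℱ t] Q) :
    -- continuous arrivals
    ((admissibleContinuous μ ℱ lam P t T).Nonempty →
      ∀ V : MarketState n → EReal,
        IsValueFunction (μ.map (stateAt P t X Q)) (admissibleContinuous μ ℱ lam P t T)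
            (fun u => objective μ (fun y => y) (stateAt P t X Q)
              (terminalWealth A X Q (continuousArrivals lam P t T u) u)) V
          ↔ V =ᵐ[μ.map (stateAt P t X Q)] staticFormula μ lam P t T (stateAt P t X Q)) ∧
    -- Poisson arrivals
    (∀ N : CubeProcess Ω n → Fin n → ℝ≥0 → Ω → ℕ,
      IsCadlagOn μ P t T →
      (∀ u ∈ admissiblePoisson μ ℱ lam P t T,
        IsControlledPoisson μ ℱ lam P t T u (N u) ∧ NoCommonJumps μ P t T (N u)) →
      (admissiblePoisson μ ℱ lam P t T).Nonempty →
      ∀ V : MarketState n → EReal,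
        IsValueFunction (μ.map (stateAt P t X Q)) (admissiblePoisson μ ℱ lam P t T)
            (fun u => objective μ (fun y => y) (stateAt P t X Q)
              (terminalWealth A X Q (poissonArrivals (N u) t T) u)) V
          ↔ V =ᵐ[μ.map (stateAt P t X Q)] staticFormula μ lam P t T (stateAt P t X Q)) := by

  refine ⟨fun hne V => ?_, fun N hc hN hne V => ?_⟩
  · refine IsValueFunction.iff_ae_eq (isValueFunction_staticFormula (R := P)
      (𝒞 := {u | IsStronglyProgressive ℱ u}) htT.le hP hlam hX hQ
      (aemeasurable_of_isStronglyProgressive hP.progressive) (Eventually.of_forall fun _ => rfl)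
      (fun u hu G hG => isStronglyProgressive_comp hP.progressive hu hG)
      (fun u hu => aemeasurable_of_isStronglyProgressive hu)
      (continuousArrivals lam P t T)
      (fun u hu hf => exists_cashFlow_continuousArrivals hP hlam hu hf) hne) V
  -- `P` need not be predictable, so feedback strategies are formed from its left-limit version
  -- instead.
  · have hL : IsStronglyPredictable ℱ (leftLimitProcess P t T) :=
      isStronglyPredictable_leftLimitProcess hP.measurable_at
    refine IsValueFunction.iff_ae_eq (isValueFunction_staticFormula (R := leftLimitProcess P t T)
      (𝒞 := {u | IsStronglyPredictable ℱ u}) htT.le hP hlam hX hQ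
      (measurable_of_isStronglyPredictable hL).aemeasurable
      (ae_leftLimitProcess_eq htT.le hP.progressive hc)
      (fun u hu G hG => isStronglyPredictable_comp hL hu hG)
      (fun u hu => (measurable_of_isStronglyPredictable hu).aemeasurable)
      (fun u => poissonArrivals (N u) t T)
      (fun u hu hf => exists_cashFlow_poissonArrivals htT.le hP hlam hc hu hf
        (hN u ⟨hu, hf⟩).1 (hN u ⟨hu, hf⟩).2) hne) V
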